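/- **Setting.** Let $dx$ be the uniform probability measure on $\mathbb S^2$, $\|\cdot\|_p$ the norm of $L^p(\mathbb S^2,dx)$, and $Y_{\ell,m}$ ($\ell\ge 0$, $-\ell\le m\le \ell$) the real spherical harmonics, orthonormal for $dx$. Fix $B>1$ and $b\in C^\infty(\mathbb R)$ vanishing outside $[B^{-1},B]$ with $\sum_{j\ge 0}b^2(\ell/B^j)=1$ for every integer $\ell\ge 1$. For each $j\ge 0$ let $\xi_{j,k}\in\mathbb S^2$ and $\lambda_{j,k}>0$ ($1\le k\le K_j$, $K_j\simeq B^{2j}$) be cubature points and weights, exact for polynomials of degree at most $2\lfloor B^{j+1}\rfloor$. The needlets are $$\psi_{j,k}(x)=\sqrt{\lambda_{j,k}}\sum_{B^{j-1}\le \ell\le B^{j+1}} b\!\left(\frac{\ell}{B^j}\right)\sum_{m=-\ell}^{\ell}Y_{\ell,m}(\xi_{j,k})\,Y_{\ell,m}(x).$$ Let $Y_i=g(X_i)+\sigma(X_i)\varepsilon_i$, $i=1,\dots,N$, with $N\ge 2$, where $g,\sigma$ are measurable, $|g|\le G$, $0\le\sigma\le S$; the $X_i$ are i.i.d. uniform on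 $\mathbb S^2$; the $\varepsilon_i$ are i.i.d., independent of the $X_i$, centred, of unit variance and sub-Gaussian: $\mathbb E e^{t\varepsilon_i}\le e^{\sigma_\varepsilon^2t^2/2}$ for all $t\in\mathbb R$, and $\|\varepsilon_i\|_{\psi_2}=\inf\{t>0:\mathbb E e^{\varepsilon_i^2/t^2}\le 2\}\le K_\varepsilon$. Put $h=g^2+\sigma^2$, $h_{j,k}=\int h\,\psi_{j,k}\,dx$, $\widehat h_{j,k}=\frac1N\sum_{i=1}^N Y_i^2\psi_{j,k}(X_i)$ and $\tau_N=\sqrt{\log N/N}$. **Proposition (deviation and moment control for $\widehat h_{j,k}$).** 1. There are constants $C_{\psi,2},C_{\psi,\infty}>0$ with $\|\psi_{j,k}\|_2\le C_{\psi,2}$ and $\|\psi_{j,k}\|_\infty\le C_{\psi,\infty}B^j$ for all $j,k$. 2. There are absolute constants $c_S,c_\eta,C>0$ such that the following holds for all $C_{\psi,2},C_{\psi,\infty}$ as in 1. For $\delta>0$ let $$\kappa^*=\max\Big\{3G^2\delta C_{\psi,\infty}+\sqrt{9G^4\delta^2C_{\psi,\infty}^2+18G^4\delta C_{\psi,2}^2},\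 \ \frac{4C_{\psi,\infty}GS\sigma_\varepsilon}{\sqrt{6c_S}}\,\delta,\ \ 2C_{\psi,2}GS\sigma_\varepsilon\sqrt{\frac{\delta}{c_S}},\ \ \frac{6K_\varepsilon^2S^2C_{\psi,\infty}}{c_\eta}\,\delta,\ \ 6K_\varepsilon^2S^2C_{\psi,2}\sqrt{\frac{\delta}{c_\eta}}\Big\}.$$ Then for every $\kappa>\kappa^*$, every $N$, every $j\ge0$ with $B^{2j}\le N/\log N$ and every $k$, $$\Pr\big(|\widehat h_{j,k}-h_{j,k}|\ge\kappa\tau_N\big)\le C\,N^{-\delta}.$$ 3. For every $r>0$ there is a constant $C'>0$, depending only on $r$, the needlet system, $G$, $S$, $\sigma_\varepsilon$ and $K_\varepsilon$, such that for every $N$, every $j\ge0$ with $B^{2j}\le N/\log N$ and every $k$, $$\mathbb E\,|\widehat h_{j,k}-h_{j,k}|^r\le C'N^{-r/2},\qquad \mathbb E\sup_{1\le k\le K_j}|\widehat h_{j,k}-h_{j,k}|^r\le C'(j+1)^rN^{-r/2}.$$ -/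

import Mathlib

open MeasureTheory ProbabilityTheory
open scoped NNReal ENNReal

noncomputable section

/-- The unit sphere `𝕊²` in `ℝ³`. -/
abbrev S2 : Type := Metric.sphere (0 : EuclideanSpace ℝ (Fin 3)) 1

/-- The uniform probability measure on `𝕊²`: the surface measure divided by its total mass. -/
def unifS2 : Measure S2 :=
  ((volume : Measure (EuclideanSpace ℝ (Fin 3))).toSphere Set.univ)⁻¹ •
    (volume : Measure (EuclideanSpace ℝ (Fin 3))).toSphere

/-! ### Real spherical harmonics -/

/-- The Legendre polynomial `P_ℓ`, by Rodrigues' formula. -/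
def legendreP (l : ℕ) : Polynomial ℝ :=
  Polynomial.C (1 / (2 ^ l * (l.factorial : ℝ))) *
    Polynomial.derivative^[l] ((Polynomial.X ^ 2 - 1) ^ l)

/-- The associated Legendre function `P_{ℓ,m}(t) = (1 - t²)^{m/2} (d/dt)^m P_ℓ(t)`. -/
def assocLegendre (l m : ℕ) (t : ℝ) : ℝ :=
  Real.sqrt (1 - t ^ 2) ^ m * (Polynomial.derivative^[m] (legendreP l)).eval t

/-- The normalising factor of `Y_{ℓ,m}` for `m ≠ 0`, with respect to the uniform *probability*
measure (that is, `√(4π)` times the factor for the surface measure of mass `4π`). -/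
def harmonicNorm (l m : ℕ) : ℝ :=
  Real.sqrt (2 * (2 * l + 1) * ((l - m).factorial : ℝ) / ((l + m).factorial : ℝ))

/-- The real spherical harmonic `Y_{ℓ,m}`, `-ℓ ≤ m ≤ ℓ`, orthonormal for the uniform probability
measure, in Cartesian coordinates `x = (x₀, x₁, x₂) = (sin ϑ cos φ, sin ϑ sin φ, cos ϑ)`, where
`(sin ϑ)^m cos (m φ)` and `(sin ϑ)^m sin (m φ)` are the real and imaginary parts of
`(x₀ + i x₁)^m`; see `sphericalHarmonic_polar` for the usual form. -/
def sphericalHarmonic (l : ℕ) (m : ℤ) (x : S2) : ℝ :=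
  if m < 0 then
    harmonicNorm l m.natAbs *
      (Polynomial.derivative^[m.natAbs] (legendreP l)).eval (x.1 2) *
      (((x.1 0 : ℂ) + (x.1 1 : ℂ) * Complex.I) ^ m.natAbs).im
  else if m = 0 then
    Real.sqrt (2 * l + 1) * (legendreP l).eval (x.1 2)
  else
    harmonicNorm l m.natAbs *
      (Polynomial.derivative^[m.natAbs] (legendreP l)).eval (x.1 2) *
      (((x.1 0 : ℂ) + (x.1 1 : ℂ) * Complex.I) ^ m.natAbs).re

/-- `Y_{ℓ,m}` in spherical coordinates `ϑ ∈ [0, π]`, `φ`. -/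
theorem sphericalHarmonic_polar (l : ℕ) (m : ℤ) (x : S2) (θ φ : ℝ) (h0 : 0 ≤ θ)
    (hpi : θ ≤ Real.pi) (hx0 : x.1 0 = Real.sin θ * Real.cos φ)
    (hx1 : x.1 1 = Real.sin θ * Real.sin φ) (hx2 : x.1 2 = Real.cos θ) :
    sphericalHarmonic l m x =
      if m < 0 then
        harmonicNorm l m.natAbs * assocLegendre l m.natAbs (Real.cos θ) *
          Real.sin (m.natAbs * φ)
      else if m = 0 then Real.sqrt (2 * l + 1) * (legendreP l).eval (Real.cos θ)
      else
        harmonicNorm l m.natAbs * assocLegendre l m.natAbs (Real.cos θ) *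
          Real.cos (m.natAbs * φ) := by
  have hs : Real.sqrt (1 - Real.cos θ ^ 2) = Real.sin θ := by
    rw [← Real.sin_sq, Real.sqrt_sq (Real.sin_nonneg_of_nonneg_of_le_pi h0 hpi)]
  have hz : ∀ n : ℕ, ((x.1 0 : ℂ) + (x.1 1 : ℂ) * Complex.I) ^ n =
      ((Real.sin θ ^ n * Real.cos (n * φ) : ℝ) : ℂ) +
        ((Real.sin θ ^ n * Real.sin (n * φ) : ℝ) : ℂ) * Complex.I := by
    intro n
    have h1 : ((x.1 0 : ℂ) + (x.1 1 : ℂ) * Complex.I) =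
        Complex.sin θ * (Complex.cos φ + Complex.sin φ * Complex.I) := by
      rw [hx0, hx1]; push_cast; ring
    rw [h1, mul_pow, Complex.cos_add_sin_mul_I_pow]
    push_cast; ring
  unfold sphericalHarmonic assocLegendre
  rw [hz, hx2, hs]
  simp only [Complex.add_re, Complex.add_im, Complex.ofReal_re, Complex.ofReal_im,
    Complex.mul_re, Complex.mul_im, Complex.I_re, Complex.I_im, mul_zero, mul_one, sub_zero,
    zero_add, add_zero]
  split_ifs <;> ring

/-! ### Needlets -/

/-- The data from which a system of spherical needlets is built: a scale `B > 1`, a smooth window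
`b` and, at every resolution `j ≥ 0`, positive cubature weights `λ_{j,k}` and cubature points
`ξ_{j,k}`, `k = 1, …, K_j`, with `K_j ≃ B^{2j}`, exact for polynomials of degree at most
`2 ⌊B^{j+1}⌋`. -/
structure NeedletSystem where
  /-- the scaling parameter -/
  B : ℝ
  one_lt_B : 1 < B
  /-- the window function -/
  b : ℝ → ℝ
  b_smooth : ContDiff ℝ (⊤ : ℕ∞) b
  b_support : Function.support b ⊆ Set.Icc B⁻¹ B
  b_partition : ∀ l : ℕ, 1 ≤ l → HasSum (fun j : ℕ => b (l / B ^ j) ^ 2) 1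
  /-- the number of cubature points -/
  K : ℕ → ℕ
  /-- the cubature points -/
  ξ : (j : ℕ) → Fin (K j) → S2
  /-- the cubature weights -/
  wt : (j : ℕ) → Fin (K j) → ℝ
  wt_pos : ∀ j k, 0 < wt j k
  card_equiv : ∃ c C : ℝ, 0 < c ∧ 0 < C ∧
    ∀ j : ℕ, c * B ^ (2 * j) ≤ (K j : ℝ) ∧ (K j : ℝ) ≤ C * B ^ (2 * j)
  exact_quadrature : ∀ (j : ℕ) (p : MvPolynomial (Fin 3) ℝ),
    p.totalDegree ≤ 2 * ⌊B ^ (j + 1)⌋₊ →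
      ∫ x : S2, MvPolynomial.eval (fun i => x.1 i) p ∂unifS2 =
        ∑ k, wt j k * MvPolynomial.eval (fun i => (ξ j k).1 i) p

namespace NeedletSystem

/-- The multipoles of the resolution `j`: `Λ_j = {ℓ ∈ ℕ : B^{j-1} ≤ ℓ ≤ B^{j+1}}`. -/
def multipoles (𝒩 : NeedletSystem) (j : ℕ) : Finset ℕ :=
  Finset.Icc ⌈𝒩.B ^ ((j : ℤ) - 1)⌉₊ ⌊𝒩.B ^ (j + 1)⌋₊

/-- The spherical needlet `ψ_{j,k}`. -/
def psi (𝒩 : NeedletSystem) (j : ℕ) (k : Fin (𝒩.K j)) (x : S2) : ℝ :=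
  Real.sqrt (𝒩.wt j k) * ∑ l ∈ 𝒩.multipoles j, 𝒩.b (l / 𝒩.B ^ j) *
    ∑ m ∈ Finset.Icc (-(l : ℤ)) l, sphericalHarmonic l m (𝒩.ξ j k) * sphericalHarmonic l m x

/-- The needlet coefficient `f_{j,k} = ∫ f ψ_{j,k} dx`. -/
def coeff (𝒩 : NeedletSystem) (f : S2 → ℝ) (j : ℕ) (k : Fin (𝒩.K j)) : ℝ :=
  ∫ x, f x * 𝒩.psi j k x ∂unifS2

/-- `C₂ > 0` and `C∞ > 0` are constants with `‖ψ_{j,k}‖_{L²} ≤ C₂` and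
`‖ψ_{j,k}‖_∞ ≤ C∞ B^j` for all `j, k`. -/
structure NormBounds (𝒩 : NeedletSystem) (C₂ Cinf : ℝ) : Prop where
  pos_two : 0 < C₂
  pos_inf : 0 < Cinf
  two_le : ∀ j k, eLpNorm (𝒩.psi j k) 2 unifS2 ≤ ENNReal.ofReal C₂
  inf_le : ∀ j k x, |𝒩.psi j k x| ≤ Cinf * 𝒩.B ^ j

end NeedletSystem

/-! ### The heteroskedastic regression model -/

/-- The sub-Gaussian Orlicz norm `inf {t > 0 : E exp (Z² / t²) ≤ 2}` (`∞` if there is no such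
`t`). -/
def psi2Norm {Ω : Type*} [MeasurableSpace Ω] (Z : Ω → ℝ) (P : Measure Ω) : ℝ≥0∞ :=
  ⨅ (t : ℝ) (_ : 0 < t) (_ : ∫⁻ ω, ENNReal.ofReal (Real.exp (Z ω ^ 2 / t ^ 2)) ∂P ≤ 2),
    ENNReal.ofReal t

/-- The design points `X_i` are i.i.d. uniform on `𝕊²`, the errors `ε_i` are i.i.d., centred, of
unit variance, and sub-Gaussian, with variance proxy `s²` and Orlicz norm at most `K`, and the
two families are independent of each other (all the `X_i` and `ε_i` are mutually independent). -/
structure IsDesign {Ω : Type*} [MeasurableSpace Ω] (P : Measure Ω) {N : ℕ}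
    (X : Fin N → Ω → S2) (ε : Fin N → Ω → ℝ) (s K : ℝ≥0) : Prop where
  measurable_X : ∀ i, Measurable (X i)
  measurable_ε : ∀ i, Measurable (ε i)
  map_X : ∀ i, P.map (X i) = unifS2
  indep_pairs : iIndepFun (fun i ω => (X i ω, ε i ω)) P
  indep_X_ε : ∀ i, IndepFun (X i) (ε i) P
  identDistrib_ε : ∀ i i', IdentDistrib (ε i) (ε i') P P
  mean_ε : ∀ i, ∫ ω, ε i ω ∂P = 0
  var_ε : ∀ i, ∫ ω, ε i ω ^ 2 ∂P = 1
  subgaussian_ε : ∀ i, HasSubgaussianMGF (ε i) (s ^ 2) P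
  orlicz_ε : ∀ i, psi2Norm (ε i) P ≤ K

/-- The mean function `g` and the scale function `σ ≥ 0` are measurable and bounded by `G`
and `S`. -/
structure IsBoundedPair (g σ : S2 → ℝ) (G S : ℝ) : Prop where
  measurable_g : Measurable g
  measurable_σ : Measurable σ
  abs_g_le : ∀ x, |g x| ≤ G
  σ_nonneg : ∀ x, 0 ≤ σ x
  σ_le : ∀ x, σ x ≤ S

/-- The observation `Y_i = g(X_i) + σ(X_i) ε_i`. -/
def obsY {Ω : Type*} {N : ℕ} (g σ : S2 → ℝ) (X : Fin N → Ω → S2) (ε : Fin N → Ω → ℝ)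
    (i : Fin N) (ω : Ω) : ℝ :=
  g (X i ω) + σ (X i ω) * ε i ω

/-- The second-order moment function `h = g² + σ²`. -/
def secondMoment (g σ : S2 → ℝ) (x : S2) : ℝ := g x ^ 2 + σ x ^ 2

/-- The empirical coefficient `ĥ_{j,k} = N⁻¹ ∑ᵢ Y_i² ψ_{j,k}(X_i)`. -/
def hHat {Ω : Type*} {N : ℕ} (𝒩 : NeedletSystem) (g σ : S2 → ℝ) (X : Fin N → Ω → S2)
    (ε : Fin N → Ω → ℝ) (j : ℕ) (k : Fin (𝒩.K j)) (ω : Ω) : ℝ :=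
  (1 / (N : ℝ)) * ∑ i, obsY g σ X ε i ω ^ 2 * 𝒩.psi j k (X i ω)

/-- The estimation error `ĥ_{j,k} - h_{j,k}`. -/
def hErr {Ω : Type*} {N : ℕ} (𝒩 : NeedletSystem) (g σ : S2 → ℝ) (X : Fin N → Ω → S2)
    (ε : Fin N → Ω → ℝ) (j : ℕ) (k : Fin (𝒩.K j)) (ω : Ω) : ℝ :=
  hHat 𝒩 g σ X ε j k ω - 𝒩.coeff (secondMoment g σ) j k

/-- `τ_N = √(log N / N)`. -/
def tauN (N : ℕ) : ℝ := Real.sqrt (Real.log N / N)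

/-- The threshold constant `κ*`. The three groups come from the bounded term `g²(X)`, the
sub-Gaussian term `2 g(X) σ(X) ε` and the sub-exponential term `σ²(X) ε²`. -/
def kappaStar (C₂ Cinf G S s K cS cη δ : ℝ) : ℝ :=
  max (3 * G ^ 2 * δ * Cinf +
        Real.sqrt (9 * G ^ 4 * δ ^ 2 * Cinf ^ 2 + 18 * G ^ 4 * δ * C₂ ^ 2))
    (max
      (max (4 * Cinf * G * S * s / Real.sqrt (6 * cS) * δ)
        (2 * C₂ * G * S * s * Real.sqrt (δ / cS)))
      (max (6 * K ^ 2 * S ^ 2 * Cinf / cη * δ)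
        (6 * K ^ 2 * S ^ 2 * C₂ * Real.sqrt (δ / cη))))

end

/-!
The needlet coefficient estimators are sample means, so the deviation and moment bounds are
obtained from exponential moments of the summands. Of the needlets, these estimates use only
bounds for the `L²` norm and the sup norm; `‖ψ_{j,k}‖₂ ≤ 1` and `‖ψ_{j,k}‖_∞ ≤ 2 B^{j+1}` always
hold.

*Norm bounds.* The harmonics `Y_{ℓ,m}` are orthonormal (`integral_sphericalHarmonic_mul`) and
satisfy `∑_m Y_{ℓ,m}(x)² = 2ℓ + 1` (`sum_sphericalHarmonic_sq`). The latter identity is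
one-dimensional: with `w = 1 - t²`, the derivative of `∑_m (ℓ-m)!/(ℓ+m)! w^m (P_ℓ^{(m)})²`
telescopes to zero by the Legendre equation, and the value at `t = 1` is explicit
(`sum_sq_legendre`). Integrating it also gives `∫ P_ℓ²`, and the Sturm–Liouville form of the
equation gives all other integrals of associated Legendre functions. On the sphere, rotations
about the third axis separate the frequencies `m`, and Archimedes' theorem (`integral_eval_coord`,
from a Gaussian integral in polar coordinates) reduces the remaining integrals to `[-1, 1]`. If
`n = ⌊B^{j+1}⌋`, the cubature formula applied to the square of the reproducing kernel of degree `n`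
centred at `ξ_{j,k}` yields `λ_{j,k} (n+1)² ≤ 1` (`NeedletSystem.wt_mul_sq_le`), and both bounds
follow since `|b| ≤ 1` at the relevant points.

*Deviations.* Expanding `Y_i²` splits the error into three sample means (`hErr_eq`). The bounded
part `g² ψ` obeys Bernstein's inequality, whose condition is exactly the quadratic inequality
solved by the first entry of `κ*`. The other two parts have the form `u(X) ψ(X) η` with `η = ε / s`
or `η = ε² / (4K²)` independent of `X` and `E (e^η + e^{-η}) ≤ 4`; for these
`E exp (aη) ≤ exp (E aη + 32 E a²)` as long as `|a| ≤ 1/2` (`integral_exp_mul_indep_le`). In all cases the Chernoff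
bound is used with parameter `2L / (N t)`, where `L = δ log N` is the exponent to be reached and
`t = κ τ_N / 3`; the restriction `B^{2j} ≤ N / log N` keeps this parameter in the admissible
range.

*Moments.* The same estimates, at the scale `N^{-1/2}`, bound `E exp (c √N |ĥ_{j,k} - h_{j,k}|)`
by a constant. Powers are dominated by exponentials, and a maximum over `K_j ≤ e^L` indices, with
`L` of order `j + 1`, costs only a factor `L^r` (`integral_iSup_rpow_le`).
-/

/-! ### Legendre polynomials and their derivatives -/

section Legendre

open Polynomial

theorem iterate_derivative_X_sq_sub_one_mul_derivative (f : ℝ[X]) (k : ℕ) :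
    derivative^[k + 1] ((X ^ 2 - 1) * derivative f) =
      (X ^ 2 - 1) * derivative^[k + 2] f + C (2 * ((k : ℝ) + 1)) * X * derivative^[k + 1] f +
        C (((k : ℝ) + 1) * k) * derivative^[k] f := by
  induction k with
  | zero =>
    simp only [Function.iterate_succ_apply', Function.iterate_zero_apply, derivative_mul,
      derivative_sub, derivative_X_pow, derivative_one]
    simp only [map_mul, map_add, map_one, Nat.cast_zero, map_zero, map_ofNat]
    have h2 : (C (2 : ℝ) : ℝ[X]) = 2 := map_ofNat C 2
    simp [h2]
    ring
  | succ k ih =>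
    rw [Function.iterate_succ_apply', ih]
    simp only [derivative_add, derivative_mul, derivative_sub, derivative_X_pow, derivative_one,
      derivative_C, derivative_X, Function.iterate_succ_apply']
    push_cast
    simp only [map_mul, map_add, map_one, map_natCast, map_ofNat]
    ring

theorem iterate_derivative_X_mul_succ (f : ℝ[X]) (k : ℕ) :
    derivative^[k + 1] (X * f) =
      X * derivative^[k + 1] f + C ((k : ℝ) + 1) * derivative^[k] f := by
  induction k with
  | zero => simp [derivative_mul]; ring
  | succ k ih =>
    rw [Function.iterate_succ_apply', ih]
    simp only [derivative_add, derivative_mul, derivative_C, derivative_X,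
      Function.iterate_succ_apply']
    push_cast
    simp only [map_add, map_one, map_natCast]
    ring

theorem X_sq_sub_one_mul_derivative_pow (l : ℕ) :
    (X ^ 2 - 1) * derivative ((X ^ 2 - 1 : ℝ[X]) ^ l) =
      C (2 * (l : ℝ)) * (X * (X ^ 2 - 1) ^ l) := by
  rcases l with _ | l
  · simp
  · rw [derivative_pow]
    simp only [derivative_sub, derivative_X_pow, derivative_one, map_mul, map_natCast, map_ofNat,
      Nat.add_sub_cancel]
    push_cast
    ring

/-- The differential equation of the `m`-th derivative of the Legendre polynomial. -/
theorem legendre_ode (l m : ℕ) :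
    (1 - X ^ 2) * derivative^[m + 2] (legendreP l) =
      C (2 * ((m : ℝ) + 1)) * X * derivative^[m + 1] (legendreP l) -
        C (((l : ℝ) + m + 1) * (l - m)) * derivative^[m] (legendreP l) := by
  have hit : ∀ k, derivative^[k] (legendreP l) =
      C (1 / (2 ^ l * (l.factorial : ℝ))) * derivative^[l + k] ((X ^ 2 - 1) ^ l) := by
    intro k
    rw [legendreP, iterate_derivative_C_mul, ← Function.iterate_add_apply, add_comm k l]
  have h1 := iterate_derivative_X_sq_sub_one_mul_derivative ((X ^ 2 - 1) ^ l) (l + m)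
  rw [X_sq_sub_one_mul_derivative_pow, iterate_derivative_C_mul,
    iterate_derivative_X_mul_succ] at h1
  rw [hit, hit, hit]
  rw [← add_assoc, ← add_assoc]
  push_cast at h1
  simp only [map_mul, map_add, map_sub, map_one, map_natCast, map_ofNat] at h1 ⊢
  linear_combination C (1 / (2 ^ l * (l.factorial : ℝ))) * h1

theorem natDegree_legendreP_le (l : ℕ) : (legendreP l).natDegree ≤ l := by
  have h : ((X ^ 2 - 1 : ℝ[X]) ^ l).natDegree ≤ 2 * l := by
    refine natDegree_pow_le.trans ?_
    rw [mul_comm]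
    gcongr
    compute_degree
  unfold legendreP
  refine (natDegree_C_mul_le _ _).trans ((natDegree_iterate_derivative _ _).trans ?_)
  omega

theorem iterate_derivative_legendreP_eq_zero {l m : ℕ} (h : l < m) :
    derivative^[m] (legendreP l) = 0 :=
  iterate_derivative_eq_zero ((natDegree_legendreP_le l).trans_lt h)

theorem eval_one_legendreP (l : ℕ) : (legendreP l).eval 1 = 1 := by
  have h := aeval_iterate_derivative_self (A := ℝ) ((X ^ 2 - 1 : ℝ[X]) ^ l) l 1
    (p' := (X + 1) ^ l) (by
      rw [← mul_pow]
      simp only [Algebra.algebraMap_self, Polynomial.map_id, map_one]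
      congr 1
      ring)
  rw [coe_aeval_eq_eval] at h
  rw [legendreP, eval_mul, h, eval_C]
  simp only [eval_pow, eval_add, eval_X, eval_one, nsmul_eq_mul]
  have : (l.factorial : ℝ) ≠ 0 := by positivity
  field_simp
  norm_num

/-- The ratio `(l - m)! / (l + m)!` which normalises the associated Legendre functions. -/
noncomputable def legendreRatio (l m : ℕ) : ℝ := ((l - m).factorial : ℝ) / ((l + m).factorial : ℝ)

theorem legendreRatio_zero (l : ℕ) : legendreRatio l 0 = 1 := by
  unfold legendreRatio
  simp only [Nat.sub_zero, Nat.add_zero]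
  exact div_self (by positivity)

theorem legendreRatio_succ {l m : ℕ} (h : m < l) :
    legendreRatio l (m + 1) * (((l : ℝ) + m + 1) * (l - m)) = legendreRatio l m := by
  unfold legendreRatio
  obtain ⟨d, rfl⟩ : ∃ d, l = m + d + 1 := ⟨l - m - 1, by omega⟩
  have e1 : m + d + 1 - (m + 1) = d := by omega
  have e2 : m + d + 1 - m = d + 1 := by omega
  rw [e1, e2, ← add_assoc (m + d + 1) m 1, Nat.factorial_succ d, Nat.factorial_succ (m + d + 1 + m)]
  have h1 : ((m + d + 1 + m).factorial : ℝ) ≠ 0 := by positivity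
  push_cast
  have h2 : (m : ℝ) + d + 1 + m + 1 ≠ 0 := by positivity
  field_simp
  ring

/-- The sum of squares of the normalised associated Legendre functions does not depend on the
argument: its derivative is a telescoping sum which vanishes. -/
theorem sum_sq_legendre (l : ℕ) :
    legendreP l ^ 2 + 2 * ∑ m ∈ Finset.range l, C (legendreRatio l (m + 1)) *
      ((1 - X ^ 2) ^ (m + 1) * (derivative^[m + 1] (legendreP l)) ^ 2) = 1 := by
  set E : ℕ → ℝ[X] := fun m => C (legendreRatio l m) *
    ((1 - X ^ 2) ^ m * (derivative^[m] (legendreP l) * derivative^[m + 1] (legendreP l))) with hE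
  set F : ℝ[X] := legendreP l ^ 2 + 2 * ∑ m ∈ Finset.range l, C (legendreRatio l (m + 1)) *
      ((1 - X ^ 2) ^ (m + 1) * (derivative^[m + 1] (legendreP l)) ^ 2) with hF
  have hterm : ∀ m ∈ Finset.range l, derivative (C (legendreRatio l (m + 1)) *
      ((1 - X ^ 2) ^ (m + 1) * (derivative^[m + 1] (legendreP l)) ^ 2)) = E (m + 1) - E m := by
    intro m hm
    have hode := legendre_ode l m
    have hr := legendreRatio_succ (Finset.mem_range.1 hm)
    simp only [hE]
    rw [← hr]
    simp only [derivative_mul, derivative_C, derivative_pow, derivative_sub, derivative_one,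
      derivative_X, Nat.add_sub_cancel, ← Function.iterate_succ_apply' derivative]
    simp only [map_mul, map_add, map_sub, map_one, map_natCast, map_ofNat] at hode ⊢
    push_cast
    linear_combination (C (legendreRatio l (m + 1)) * (1 - X ^ 2) ^ m *
      derivative^[m + 1] (legendreP l)) * hode
  have hd : derivative F = 0 := by
    rw [hF, derivative_add, derivative_mul, derivative_sum, Finset.sum_congr rfl hterm,
      Finset.sum_range_sub]
    have h0 : E l = 0 := by
      simp only [hE]
      rw [iterate_derivative_legendreP_eq_zero (Nat.lt_succ_self l)]
      simp
    rw [h0]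
    simp only [hE, legendreRatio_zero, derivative_pow, derivative_ofNat]
    have h2 : (C (2 : ℝ) : ℝ[X]) = 2 := map_ofNat C 2
    simp [h2]
    ring
  have hdeg := derivative_eq_zero.1 hd
  rw [eq_C_of_natDegree_eq_zero hdeg]
  have h1 : F.eval 1 = 1 := by
    simp only [hF, eval_add, eval_pow, eval_one_legendreP, eval_mul, eval_finsetSum, eval_sub,
      eval_one, eval_X, eval_C]
    simp
  rw [eq_C_of_natDegree_eq_zero hdeg, eval_C] at h1
  rw [h1, C_1]

/-- The linear functional `p ↦ ∫_{-1}^1 p(t) dt` on polynomials. -/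
noncomputable def intervalFunctional : ℝ[X] →ₗ[ℝ] ℝ where
  toFun p := ∫ t in (-1 : ℝ)..1, p.eval t
  map_add' p q := by
    simp only [eval_add]
    exact intervalIntegral.integral_add (p.continuous.intervalIntegrable _ _)
      (q.continuous.intervalIntegrable _ _)
  map_smul' c p := by
    simp only [eval_smul, RingHom.id_apply]
    exact intervalIntegral.integral_smul _ _

theorem intervalFunctional_apply (p : ℝ[X]) :
    intervalFunctional p = ∫ t in (-1 : ℝ)..1, p.eval t := rfl

theorem intervalFunctional_C_mul (c : ℝ) (p : ℝ[X]) :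
    intervalFunctional (C c * p) = c * intervalFunctional p := by
  rw [← smul_eq_C_mul, map_smul, smul_eq_mul]

theorem intervalFunctional_derivative (p : ℝ[X]) :
    intervalFunctional (derivative p) = p.eval 1 - p.eval (-1) :=
  intervalIntegral.integral_eq_sub_of_hasDerivAt (fun t _ => p.hasDerivAt t)
    (p.derivative.continuous.intervalIntegrable _ _)

/-- Integration by parts against the Sturm–Liouville form of the differential equation. -/
theorem intervalFunctional_legendre_succ (l l' m : ℕ) :
    intervalFunctional ((1 - X ^ 2) ^ (m + 1) *
      (derivative^[m + 1] (legendreP l) * derivative^[m + 1] (legendreP l'))) =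
    ((l : ℝ) + m + 1) * (l - m) * intervalFunctional ((1 - X ^ 2) ^ m *
      (derivative^[m] (legendreP l) * derivative^[m] (legendreP l'))) := by
  have hode := legendre_ode l m
  have hd : derivative ((1 - X ^ 2) ^ (m + 1) *
      (derivative^[m + 1] (legendreP l) * derivative^[m] (legendreP l'))) =
      (1 - X ^ 2) ^ (m + 1) *
        (derivative^[m + 1] (legendreP l) * derivative^[m + 1] (legendreP l')) -
      C (((l : ℝ) + m + 1) * (l - m)) * ((1 - X ^ 2) ^ m *
        (derivative^[m] (legendreP l) * derivative^[m] (legendreP l'))) := by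
    simp only [derivative_mul, derivative_pow, derivative_sub, derivative_one,
      derivative_X, Nat.add_sub_cancel, ← Function.iterate_succ_apply' derivative]
    simp only [map_mul, map_add, map_sub, map_one, map_natCast, map_ofNat] at hode ⊢
    push_cast
    linear_combination ((1 - X ^ 2) ^ m * derivative^[m] (legendreP l')) * hode
  have hi := intervalFunctional_derivative ((1 - X ^ 2) ^ (m + 1) *
      (derivative^[m + 1] (legendreP l) * derivative^[m] (legendreP l')))
  rw [hd, map_sub, intervalFunctional_C_mul] at hi
  simp only [eval_mul, eval_pow, eval_sub, eval_one, eval_X] at hi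
  rw [show (1 : ℝ) - 1 ^ 2 = 0 by norm_num, show (1 : ℝ) - (-1) ^ 2 = 0 by norm_num,
    zero_pow (Nat.succ_ne_zero m)] at hi
  linarith

theorem intervalFunctional_legendre_of_ne {l l' : ℕ} (h : l ≠ l') (m : ℕ) :
    intervalFunctional ((1 - X ^ 2) ^ m *
      (derivative^[m] (legendreP l) * derivative^[m] (legendreP l'))) = 0 := by
  have h1 := intervalFunctional_legendre_succ l l' m
  have h2 := intervalFunctional_legendre_succ l' l m
  rw [mul_comm (derivative^[m + 1] (legendreP l')), mul_comm (derivative^[m] (legendreP l'))] at h2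
  rw [h1] at h2
  have h3 : ((l : ℝ) - l') * (l + l' + 1) * intervalFunctional ((1 - X ^ 2) ^ m *
      (derivative^[m] (legendreP l) * derivative^[m] (legendreP l'))) = 0 := by
    linear_combination h2
  have h4 : ((l : ℝ) - l') * (l + l' + 1) ≠ 0 :=
    mul_ne_zero (sub_ne_zero.2 (Nat.cast_injective.ne h)) (by positivity)
  exact (mul_eq_zero.1 h3).resolve_left h4

theorem legendreRatio_mul_intervalFunctional {l m : ℕ} (h : m ≤ l) :
    legendreRatio l m * intervalFunctional ((1 - X ^ 2) ^ m *
      (derivative^[m] (legendreP l) * derivative^[m] (legendreP l))) =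
      intervalFunctional (legendreP l ^ 2) := by
  induction m with
  | zero => simp [legendreRatio_zero, sq]
  | succ m ih =>
    rw [← ih (by omega), intervalFunctional_legendre_succ, ← mul_assoc,
      legendreRatio_succ (by omega)]

/-- The normalisation of the associated Legendre functions; the value for `m = 0` comes from
integrating `sum_sq_legendre`. -/
theorem intervalFunctional_legendre_self {l m : ℕ} (h : m ≤ l) :
    (2 * (l : ℝ) + 1) * legendreRatio l m * intervalFunctional ((1 - X ^ 2) ^ m *
      (derivative^[m] (legendreP l) * derivative^[m] (legendreP l))) = 2 := by
  rw [mul_assoc, legendreRatio_mul_intervalFunctional h]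
  have h1 := congrArg intervalFunctional (sum_sq_legendre l)
  have h2 : intervalFunctional 1 = 2 := by
    rw [intervalFunctional_apply]; simp; norm_num
  have h3 : ∀ p : ℝ[X], (2 : ℝ[X]) * p = C 2 * p := fun p => by rw [map_ofNat]
  rw [h2, map_add, h3, intervalFunctional_C_mul, map_sum] at h1
  have h4 : ∀ m ∈ Finset.range l, intervalFunctional (C (legendreRatio l (m + 1)) *
      ((1 - X ^ 2) ^ (m + 1) * (derivative^[m + 1] (legendreP l)) ^ 2)) =
      intervalFunctional (legendreP l ^ 2) := by
    intro m hm
    rw [intervalFunctional_C_mul, sq (derivative^[m + 1] (legendreP l)),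
      legendreRatio_mul_intervalFunctional (Nat.succ_le_of_lt (Finset.mem_range.1 hm))]
  rw [Finset.sum_congr rfl h4, Finset.sum_const, Finset.card_range, nsmul_eq_mul] at h1
  linear_combination h1

end Legendre

/-! ### Integration over the sphere -/

instance : IsProbabilityMeasure unifS2 := by
  refine ⟨?_⟩
  rw [unifS2, Measure.smul_apply, smul_eq_mul]
  refine ENNReal.inv_mul_cancel ?_ (measure_ne_top _ _)
  rw [Ne, Measure.measure_univ_eq_zero]
  exact Measure.toSphere_ne_zero _

theorem integral_unifS2 {F : Type*} [NormedAddCommGroup F] [NormedSpace ℝ F] (f : S2 → F) :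
    ∫ x, f x ∂unifS2 =
      ((volume : Measure (EuclideanSpace ℝ (Fin 3))).toSphere.real Set.univ)⁻¹ •
        ∫ x, f x ∂(volume : Measure (EuclideanSpace ℝ (Fin 3))).toSphere := by
  rw [unifS2, integral_smul_measure, ENNReal.toReal_inv]
  rfl

theorem Continuous.integrable_unifS2 {F : Type*} [NormedAddCommGroup F] {f : S2 → F}
    (hf : Continuous f) : Integrable f unifS2 := by
  rw [← integrableOn_univ]
  exact hf.continuousOn.integrableOn_compact isCompact_univ

/-- The action of a linear isometry of `ℝ³` on the sphere. -/
noncomputable def sphereMap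
    (R : EuclideanSpace ℝ (Fin 3) ≃ₗᵢ[ℝ] EuclideanSpace ℝ (Fin 3)) (x : S2) : S2 :=
  ⟨R x.1, by
    rw [mem_sphere_zero_iff_norm, R.norm_map]
    exact mem_sphere_zero_iff_norm.1 x.2⟩

theorem continuous_sphereMap (R : EuclideanSpace ℝ (Fin 3) ≃ₗᵢ[ℝ] EuclideanSpace ℝ (Fin 3)) :
    Continuous (sphereMap R) :=
  Continuous.subtype_mk (R.continuous.comp continuous_subtype_val) _

open scoped Pointwise in
theorem measurePreserving_sphereMap
    (R : EuclideanSpace ℝ (Fin 3) ≃ₗᵢ[ℝ] EuclideanSpace ℝ (Fin 3)) :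
    MeasurePreserving (sphereMap R) unifS2 unifS2 := by
  unfold unifS2
  refine MeasurePreserving.smul_measure ⟨(continuous_sphereMap R).measurable, ?_⟩ _
  ext s hs
  have hm := (continuous_sphereMap R).measurable
  rw [Measure.map_apply hm hs, Measure.toSphere_apply' _ (hm hs), Measure.toSphere_apply' _ hs]
  congr 1
  have himg : Set.Ioo (0 : ℝ) 1 • (Subtype.val '' (sphereMap R ⁻¹' s) :
      Set (EuclideanSpace ℝ (Fin 3))) =
      R.toMeasurableEquiv ⁻¹' (Set.Ioo (0 : ℝ) 1 • (Subtype.val '' s)) := by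
    ext v
    simp only [Set.mem_smul, Set.mem_preimage, Set.mem_image]
    constructor
    · rintro ⟨r, hr, _, ⟨x, hx, rfl⟩, rfl⟩
      exact ⟨r, hr, _, ⟨sphereMap R x, hx, rfl⟩, (R.map_smul r x.1).symm⟩
    · rintro ⟨r, hr, _, ⟨x, hx, rfl⟩, hv⟩
      have hback : sphereMap R (sphereMap R.symm x) = x := by
        ext1
        exact R.apply_symm_apply x.1
      refine ⟨r, hr, _, ⟨sphereMap R.symm x, by rwa [hback], rfl⟩, ?_⟩
      apply R.injective
      rw [R.map_smul]
      change r • (sphereMap R (sphereMap R.symm x)).1 = R v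
      rw [hback]
      exact hv
  rw [himg]
  exact R.measurePreserving.measure_preimage_equiv (f := R.toMeasurableEquiv) _

theorem integral_comp_sphereMap {F : Type*} [NormedAddCommGroup F] [NormedSpace ℝ F]
    (R : EuclideanSpace ℝ (Fin 3) ≃ₗᵢ[ℝ] EuclideanSpace ℝ (Fin 3)) (f : S2 → F)
    (hf : Continuous f) : ∫ x, f (sphereMap R x) ∂unifS2 = ∫ x, f x ∂unifS2 := by
  have h := measurePreserving_sphereMap R
  rw [← integral_map h.measurable.aemeasurable
    (by rw [h.map_eq]; exact hf.integrable_unifS2.aestronglyMeasurable), h.map_eq]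

/-- Integration in polar coordinates of a function which separates the angular and the radial
variable. -/
theorem integral_eq_toSphere_mul_radial (F : EuclideanSpace ℝ (Fin 3) → ℝ) (f : S2 → ℝ)
    (ρ : ℝ → ℝ) (h : ∀ (r : ℝ) (y : S2), 0 < r → F (r • y.1) = f y * ρ r) :
    ∫ x, F x = (∫ y, f y ∂(volume : Measure (EuclideanSpace ℝ (Fin 3))).toSphere) *
      ∫ r in Set.Ioi (0 : ℝ), r ^ 2 * ρ r := by
  set μ : Measure (EuclideanSpace ℝ (Fin 3)) := volume
  have hdim : Module.finrank ℝ (EuclideanSpace ℝ (Fin 3)) - 1 = 2 := by simp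
  have hpt : ∀ x : ({(0)}ᶜ : Set (EuclideanSpace ℝ (Fin 3))), F x.1 =
      f (homeomorphUnitSphereProd _ x).1 * ρ (homeomorphUnitSphereProd _ x).2.1 := by
    intro x
    have hx : 0 < ‖x.1‖ := norm_pos_iff.2 x.2
    have hy : F (‖x.1‖ • (homeomorphUnitSphereProd _ x).1.1) =
      f (homeomorphUnitSphereProd _ x).1 * ρ ‖x.1‖ := h _ _ hx
    rw [homeomorphUnitSphereProd_apply_snd_coe, ← hy]
    congr 1
    rw [homeomorphUnitSphereProd_apply_fst_coe, smul_smul, mul_inv_cancel₀ hx.ne', one_smul]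
  calc ∫ x, F x ∂μ = ∫ x : ({(0)}ᶜ : Set (EuclideanSpace ℝ (Fin 3))), F x.1 ∂(μ.comap (↑)) := by
        rw [integral_subtype_comap (measurableSet_singleton _).compl F, restrict_compl_singleton]
    _ = ∫ p, f p.1 * ρ p.2.1 ∂μ.toSphere.prod (.volumeIoiPow 2) := by
        simp_rw [hpt]
        have hmp := μ.measurePreserving_homeomorphUnitSphereProd
        rw [hdim] at hmp
        exact hmp.integral_comp (Homeomorph.measurableEmbedding _)
          (fun p : S2 × Set.Ioi (0 : ℝ) => f p.1 * ρ p.2.1)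
    _ = (∫ y, f y ∂μ.toSphere) * ∫ r : Set.Ioi (0 : ℝ), ρ r.1 ∂.volumeIoiPow 2 :=
        integral_prod_mul (fun y => f y) (fun r : Set.Ioi (0 : ℝ) => ρ r.1)
    _ = _ := by
        congr 1
        simp only [Measure.volumeIoiPow, ENNReal.ofReal]
        rw [integral_withDensity_eq_integral_smul,
          integral_subtype_comap measurableSet_Ioi fun a : ℝ => Real.toNNReal (a ^ 2) • ρ a,
          setIntegral_congr_fun measurableSet_Ioi fun x hx => ?_]
        · rw [NNReal.smul_def, Real.coe_toNNReal _ (sq_nonneg x), smul_eq_mul]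
        · exact (measurable_subtype_coe.pow_const _).real_toNNReal

theorem integral_Ioi_pow_mul_exp_neg_sq (n : ℕ) :
    ∫ r in Set.Ioi (0 : ℝ), r ^ n * Real.exp (-r ^ 2) = Real.Gamma (((n : ℝ) + 1) / 2) / 2 := by
  have h := integral_rpow_mul_exp_neg_rpow (p := 2) (q := n) (by norm_num)
    (by have : (0 : ℝ) ≤ n := by positivity
        linarith)
  simp only [Real.rpow_natCast, Real.rpow_ofNat] at h
  rw [h]
  ring

theorem integral_pow_mul_exp_neg_sq (k : ℕ) :
    ∫ t : ℝ, t ^ (2 * k) * Real.exp (-t ^ 2) =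
      Real.Gamma ((((2 * k : ℕ) : ℝ) + 1) / 2) := by
  have h := integral_comp_abs (f := fun t : ℝ => t ^ (2 * k) * Real.exp (-t ^ 2))
  simp only [pow_mul, sq_abs] at h
  simp only [pow_mul]
  rw [h]
  have h2 := integral_Ioi_pow_mul_exp_neg_sq (2 * k)
  simp only [pow_mul] at h2
  rw [h2]
  ring

/-- The Gaussian integral of an even power of one coordinate, by Fubini. -/
theorem integral_coord_pow_mul_exp_neg_norm_sq (k : ℕ) :
    ∫ x : EuclideanSpace ℝ (Fin 3), x 2 ^ (2 * k) * Real.exp (-‖x‖ ^ 2) =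
      Real.Gamma (1 / 2) ^ 2 * Real.Gamma ((((2 * k : ℕ) : ℝ) + 1) / 2) := by
  have h0 := (EuclideanSpace.volume_preserving_symm_measurableEquiv_toLp (Fin 3)).integral_comp
    (MeasurableEquiv.measurableEmbedding _)
    (fun x : Fin 3 → ℝ => ∏ i, (if i = 2 then x i ^ (2 * k) else 1) * Real.exp (-x i ^ 2))
  have h1 : ∀ x : EuclideanSpace ℝ (Fin 3), x 2 ^ (2 * k) * Real.exp (-‖x‖ ^ 2) =
      ∏ i, (if i = 2 then x i ^ (2 * k) else 1) * Real.exp (-x i ^ 2) := by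
    intro x
    rw [EuclideanSpace.norm_sq_eq, Fin.sum_univ_three, Fin.prod_univ_three]
    simp only [Real.norm_eq_abs, sq_abs, neg_add, Real.exp_add]
    simp
    ring
  simp_rw [h1]
  refine Eq.trans h0 ?_
  rw [integral_fintype_prod_volume_eq_prod (f := fun (i : Fin 3) (t : ℝ) =>
    (if i = 2 then t ^ (2 * k) else 1) * Real.exp (-t ^ 2)), Fin.prod_univ_three]
  have h2 := integral_pow_mul_exp_neg_sq 0
  simp only [mul_zero, pow_zero, Nat.cast_zero, zero_add] at h2
  have e0 : (0 : Fin 3) ≠ 2 := by decide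
  have e1 : (1 : Fin 3) ≠ 2 := by decide
  simp only [e0, e1, if_true, if_false]
  rw [h2, integral_pow_mul_exp_neg_sq]
  ring

theorem toSphere_coord_pow_even (k : ℕ) :
    (∫ y : S2, y.1 2 ^ (2 * k) ∂(volume : Measure (EuclideanSpace ℝ (Fin 3))).toSphere) *
      (2 * (k : ℝ) + 1) = 4 * Real.Gamma (1 / 2) ^ 2 := by
  have h := integral_eq_toSphere_mul_radial
    (fun x => x 2 ^ (2 * k) * Real.exp (-‖x‖ ^ 2)) (fun y => y.1 2 ^ (2 * k))
    (fun r => r ^ (2 * k) * Real.exp (-r ^ 2)) (by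
      intro r y hr
      have hy : ‖y.1‖ = 1 := mem_sphere_zero_iff_norm.1 y.2
      simp only [norm_smul, hy, Real.norm_eq_abs, abs_of_pos hr, PiLp.smul_apply, smul_eq_mul]
      ring_nf)
  rw [integral_coord_pow_mul_exp_neg_norm_sq] at h
  have h2 : ∀ r : ℝ, r ^ 2 * (r ^ (2 * k) * Real.exp (-r ^ 2)) =
      r ^ (2 * k + 2) * Real.exp (-r ^ 2) := fun r => by ring
  simp_rw [h2] at h
  rw [integral_Ioi_pow_mul_exp_neg_sq] at h
  have h3 : (((2 * k + 2 : ℕ) : ℝ) + 1) / 2 = (((2 * k : ℕ) : ℝ) + 1) / 2 + 1 := by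
    push_cast; ring
  have hpos : 0 < (((2 * k : ℕ) : ℝ) + 1) / 2 := by positivity
  rw [h3, Real.Gamma_add_one hpos.ne'] at h
  have hG := Real.Gamma_pos_of_pos hpos
  push_cast at h hG
  have h4 : Real.Gamma ((2 * (k : ℝ) + 1) / 2) *
      ((∫ y : S2, y.1 2 ^ (2 * k) ∂(volume : Measure (EuclideanSpace ℝ (Fin 3))).toSphere) *
      (2 * (k : ℝ) + 1) - 4 * Real.Gamma (1 / 2) ^ 2) = 0 := by
    linear_combination (-4) * h
  linarith [(mul_eq_zero.1 h4).resolve_left hG.ne']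

/-- **Archimedes' theorem** for polynomials: a coordinate of a uniform point of `𝕊²` is uniformly
distributed on `[-1, 1]`. -/
theorem integral_eval_coord (q : Polynomial ℝ) :
    ∫ x : S2, q.eval (x.1 2) ∂unifS2 = intervalFunctional q / 2 := by
  have hc : ∀ q : Polynomial ℝ, Continuous fun x : S2 => q.eval (x.1 2) := fun q => by
    have := q.continuous
    fun_prop
  induction q using Polynomial.induction_on' with
  | add p q hp hq =>
    simp only [Polynomial.eval_add]
    rw [integral_add (hc p).integrable_unifS2 (hc q).integrable_unifS2, hp, hq, map_add]
    ring
  | monomial n a =>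
    rw [intervalFunctional_apply]
    simp only [Polynomial.eval_monomial]
    rw [integral_const_mul, intervalIntegral.integral_const_mul, integral_pow]
    rcases Nat.even_or_odd' n with ⟨k, rfl | rfl⟩
    · rw [integral_unifS2]
      have h0 := toSphere_coord_pow_even 0
      have hk := toSphere_coord_pow_even k
      simp only [mul_zero, pow_zero, Nat.cast_zero, zero_add, mul_one, integral_const,
        smul_eq_mul] at h0
      have hG : 0 < Real.Gamma (1 / 2) := Real.Gamma_pos_of_pos (by norm_num)
      have h2 : (-1 : ℝ) ^ (2 * k + 1) = -1 := by rw [pow_succ, pow_mul]; norm_num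
      rw [h2, h0, smul_eq_mul]
      have h3 : (2 * (k : ℝ) + 1) ≠ 0 := by positivity
      rw [← eq_div_iff h3] at hk
      rw [hk]
      push_cast
      field_simp
      ring
    · have h := integral_comp_sphereMap (LinearIsometryEquiv.neg ℝ)
        (fun x : S2 => x.1 2 ^ (2 * k + 1)) (by fun_prop)
      have h2 : ∀ x : S2, (sphereMap (LinearIsometryEquiv.neg ℝ) x).1 2 = -x.1 2 := fun x => rfl
      have h5 : ∀ x : S2, (-x.1 2) ^ (2 * k + 1) = -(x.1 2 ^ (2 * k + 1)) := fun x =>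
        Odd.neg_pow ⟨k, rfl⟩ _
      simp only [h2, h5] at h
      rw [integral_neg] at h
      have h3 : ∫ x : S2, x.1 2 ^ (2 * k + 1) ∂unifS2 = 0 := self_eq_neg.1 h.symm
      rw [h3]
      have h4 : (-1 : ℝ) ^ (2 * k + 1 + 1) = 1 := by
        rw [show 2 * k + 1 + 1 = 2 * (k + 1) by ring, pow_mul]; norm_num
      rw [h4]
      simp

/-- The rotation of `ℝ³` by the angle `θ` about the third axis. -/
noncomputable def rotZ (θ : ℝ) : EuclideanSpace ℝ (Fin 3) ≃ₗᵢ[ℝ] EuclideanSpace ℝ (Fin 3) :=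
  LinearIsometry.toLinearIsometryEquiv
    { toFun := fun x => !₂[Real.cos θ * x 0 - Real.sin θ * x 1,
        Real.sin θ * x 0 + Real.cos θ * x 1, x 2]
      map_add' := fun x y => by
        ext i; fin_cases i <;> simp <;> ring
      map_smul' := fun c x => by
        ext i; fin_cases i <;> simp <;> ring
      norm_map' := fun x => by
        simp only [LinearMap.coe_mk, AddHom.coe_mk]
        rw [EuclideanSpace.norm_eq, EuclideanSpace.norm_eq, Fin.sum_univ_three,
          Fin.sum_univ_three]
        simp only [Real.norm_eq_abs, sq_abs]
        congr 1
        simp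
        linear_combination (x 0 ^ 2 + x 1 ^ 2) * Real.sin_sq_add_cos_sq θ }
    rfl

theorem sphereMap_rotZ_zero (θ : ℝ) (x : S2) :
    (sphereMap (rotZ θ) x).1 0 = Real.cos θ * x.1 0 - Real.sin θ * x.1 1 := rfl

theorem sphereMap_rotZ_one (θ : ℝ) (x : S2) :
    (sphereMap (rotZ θ) x).1 1 = Real.sin θ * x.1 0 + Real.cos θ * x.1 1 := rfl

theorem sphereMap_rotZ_two (θ : ℝ) (x : S2) : (sphereMap (rotZ θ) x).1 2 = x.1 2 := rfl

/-- The complex horizontal coordinate `x₀ + i x₁`. -/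
noncomputable def horiz (x : S2) : ℂ := (x.1 0 : ℂ) + (x.1 1 : ℂ) * Complex.I

theorem continuous_horiz : Continuous horiz := by
  unfold horiz
  fun_prop

theorem S2.sum_sq (x : S2) : x.1 0 ^ 2 + x.1 1 ^ 2 + x.1 2 ^ 2 = 1 := by
  have hx : ‖x.1‖ = 1 := mem_sphere_zero_iff_norm.1 x.2
  have h := EuclideanSpace.norm_sq_eq x.1
  rw [hx, Fin.sum_univ_three] at h
  simp only [Real.norm_eq_abs, sq_abs] at h
  linarith

theorem horiz_mul_conj (x : S2) :
    horiz x * (starRingEnd ℂ) (horiz x) = ((1 - x.1 2 ^ 2 : ℝ) : ℂ) := by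
  rw [Complex.mul_conj]
  congr 1
  have h := S2.sum_sq x
  simp only [horiz, Complex.normSq_apply]
  simp
  linarith

theorem horiz_rotZ (θ : ℝ) (x : S2) :
    horiz (sphereMap (rotZ θ) x) = Complex.exp (θ * Complex.I) * horiz x := by
  unfold horiz
  rw [sphereMap_rotZ_zero, sphereMap_rotZ_one, Complex.exp_mul_I]
  push_cast
  linear_combination ((-1 : ℂ) * Complex.sin θ * (x.1 1 : ℂ)) * Complex.I_sq

/-- Averaging over the rotations about the third axis kills every nonzero frequency. -/
theorem integral_horiz_of_ne (q : Polynomial ℝ) {a b : ℕ} (hab : a ≠ b) :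
    ∫ x : S2, ((q.eval (x.1 2) : ℝ) : ℂ) * (horiz x ^ a * (starRingEnd ℂ) (horiz x) ^ b)
      ∂unifS2 = 0 := by
  set f : S2 → ℂ := fun x =>
    ((q.eval (x.1 2) : ℝ) : ℂ) * (horiz x ^ a * (starRingEnd ℂ) (horiz x) ^ b) with hf
  have hcont : Continuous f := by
    have h1 := q.continuous
    have h2 := continuous_horiz
    have h3 : Continuous fun x : S2 => (starRingEnd ℂ) (horiz x) := Complex.continuous_conj.comp h2
    simp only [hf]
    fun_prop
  have hab' : (a : ℝ) - b ≠ 0 := sub_ne_zero.2 (Nat.cast_injective.ne hab)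
  -- the angle for which the integrand changes its sign
  set θ : ℝ := Real.pi / (a - b) with hθ
  have hrot : ∀ x, f (sphereMap (rotZ θ) x) = -f x := by
    intro x
    have hexp : Complex.exp (θ * Complex.I) ^ a *
        (starRingEnd ℂ) (Complex.exp (θ * Complex.I)) ^ b = -1 := by
      rw [← Complex.exp_conj, map_mul, Complex.conj_ofReal, Complex.conj_I, ← Complex.exp_nat_mul,
        ← Complex.exp_nat_mul, ← Complex.exp_add, ← Complex.exp_pi_mul_I]
      congr 1
      have h1 : (θ : ℂ) * ((a : ℂ) - b) = Real.pi := by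
        rw [hθ]
        push_cast
        have h2 : (a : ℂ) - b ≠ 0 := by exact_mod_cast hab'
        field_simp
      linear_combination Complex.I * h1
    simp only [hf, horiz_rotZ, sphereMap_rotZ_two, map_mul, mul_pow]
    linear_combination (((q.eval (x.1 2) : ℝ) : ℂ) *
      (horiz x ^ a * (starRingEnd ℂ) (horiz x) ^ b)) * hexp
  have h := integral_comp_sphereMap (rotZ θ) f hcont
  simp only [hrot] at h
  rw [integral_neg] at h
  exact self_eq_neg.1 h.symm

/-! ### Orthonormality and the addition theorem -/

/-- The angular factor of `Y_{ℓ,m}`: the real part of `(x₀ + i x₁)^m` for `m ≥ 0` and the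
imaginary part of `(x₀ + i x₁)^{-m}` for `m < 0`. -/
noncomputable def angularFactor (m : ℤ) (x : S2) : ℝ :=
  if m < 0 then (horiz x ^ m.natAbs).im else (horiz x ^ m.natAbs).re

/-- The normalising factor of `Y_{ℓ,m}`, including the case `m = 0`. -/
noncomputable def harmonicCoeff (l : ℕ) (m : ℤ) : ℝ :=
  if m = 0 then Real.sqrt (2 * l + 1) else harmonicNorm l m.natAbs

theorem sphericalHarmonic_eq (l : ℕ) (m : ℤ) (x : S2) :
    sphericalHarmonic l m x = harmonicCoeff l m *
      (Polynomial.derivative^[m.natAbs] (legendreP l)).eval (x.1 2) * angularFactor m x := by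
  unfold sphericalHarmonic harmonicCoeff angularFactor horiz
  rcases lt_trichotomy m 0 with h | h | h
  · rw [if_pos h, if_pos h, if_neg h.ne]
  · subst h
    simp
  · rw [if_neg h.not_gt, if_neg h.ne', if_neg h.ne', if_neg h.not_gt]

theorem continuous_angularFactor (m : ℤ) : Continuous (angularFactor m) := by
  have h := continuous_horiz
  unfold angularFactor
  split_ifs
  · exact Complex.continuous_im.comp (h.pow _)
  · exact Complex.continuous_re.comp (h.pow _)

theorem continuous_sphericalHarmonic (l : ℕ) (m : ℤ) : Continuous (sphericalHarmonic l m) := by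
  have h : sphericalHarmonic l m = fun x => harmonicCoeff l m *
      (Polynomial.derivative^[m.natAbs] (legendreP l)).eval (x.1 2) * angularFactor m x :=
    funext (sphericalHarmonic_eq l m)
  rw [h]
  have h1 := continuous_angularFactor m
  have h2 := (Polynomial.derivative^[m.natAbs] (legendreP l)).continuous
  fun_prop

theorem harmonicCoeff_zero_sq (l : ℕ) : harmonicCoeff l 0 ^ 2 = 2 * l + 1 := by
  rw [harmonicCoeff, if_pos rfl, Real.sq_sqrt (by positivity)]

theorem harmonicCoeff_sq {l : ℕ} {m : ℤ} (hm : m ≠ 0) :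
    harmonicCoeff l m ^ 2 = 2 * (2 * l + 1) * legendreRatio l m.natAbs := by
  rw [harmonicCoeff, if_neg hm, harmonicNorm, Real.sq_sqrt (by positivity), legendreRatio]
  ring

theorem integral_re_im_horiz (q : Polynomial ℝ) {a b : ℕ} (hab : a ≠ b) :
    (∫ x : S2, q.eval (x.1 2) * (horiz x ^ a * (starRingEnd ℂ) (horiz x) ^ b).re ∂unifS2 = 0) ∧
    ∫ x : S2, q.eval (x.1 2) * (horiz x ^ a * (starRingEnd ℂ) (horiz x) ^ b).im ∂unifS2 = 0 := by
  have h := integral_horiz_of_ne q hab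
  have hint : Integrable (fun x : S2 => ((q.eval (x.1 2) : ℝ) : ℂ) *
      (horiz x ^ a * (starRingEnd ℂ) (horiz x) ^ b)) unifS2 := by
    apply Continuous.integrable_unifS2
    have h1 := q.continuous
    have h2 := continuous_horiz
    have h3 : Continuous fun x : S2 => (starRingEnd ℂ) (horiz x) := Complex.continuous_conj.comp h2
    fun_prop
  have hre := integral_re hint
  have him := integral_im hint
  rw [h] at hre him
  constructor
  · simpa [Complex.re_ofReal_mul] using hre
  · simpa [Complex.im_ofReal_mul] using him

theorem continuous_eval_coord_mul_re_im (q : Polynomial ℝ) (a b : ℕ) :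
    (Continuous fun x : S2 =>
      q.eval (x.1 2) * (horiz x ^ a * (starRingEnd ℂ) (horiz x) ^ b).re) ∧
    Continuous fun x : S2 =>
      q.eval (x.1 2) * (horiz x ^ a * (starRingEnd ℂ) (horiz x) ^ b).im := by
  have h1 : Continuous fun x : S2 => q.eval (x.1 2) := by
    have := q.continuous
    fun_prop
  have h2 := continuous_horiz
  have h3 : Continuous fun x : S2 => horiz x ^ a * (starRingEnd ℂ) (horiz x) ^ b :=
    (h2.pow a).mul ((Complex.continuous_conj.comp h2).pow b)
  exact ⟨h1.mul (Complex.continuous_re.comp h3), h1.mul (Complex.continuous_im.comp h3)⟩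

theorem integral_angularFactor_of_ne (q : Polynomial ℝ) {m m' : ℤ} (h : m ≠ m') :
    ∫ x : S2, q.eval (x.1 2) * (angularFactor m x * angularFactor m' x) ∂unifS2 = 0 := by
  set a := m.natAbs with ha
  set b := m'.natAbs with hb
  have hab : a + b ≠ 0 := by omega
  -- products of angular factors are combinations of the frequencies `a + b` and `a - b`
  have hkey : ∃ (f g : ℂ →ₗ[ℝ] ℝ), ((f = Complex.reLm ∧ g = Complex.reLm ∨
      f = Complex.imLm ∧ g = Complex.imLm)) ∧ ∃ c d : ℝ, (a = b → d = 0) ∧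
      ∀ x, angularFactor m x * angularFactor m' x = c * f (horiz x ^ (a + b) *
        (starRingEnd ℂ) (horiz x) ^ 0) +
        d * g (horiz x ^ a * (starRingEnd ℂ) (horiz x) ^ b) := by
    unfold angularFactor
    rw [← ha, ← hb]
    by_cases h1 : m < 0 <;> by_cases h2 : m' < 0
    · refine ⟨Complex.reLm, Complex.reLm, Or.inl ⟨rfl, rfl⟩, -1 / 2, 1 / 2,
        fun h => by omega, fun x => ?_⟩
      simp only [if_pos h1, if_pos h2, pow_add, pow_zero, mul_one, ← map_pow, Complex.reLm_coe,
        Complex.mul_re, Complex.conj_re, Complex.conj_im]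
      ring
    · by_cases hab' : a = b
      · refine ⟨Complex.imLm, Complex.imLm, Or.inr ⟨rfl, rfl⟩, 1 / 2, 0, fun _ => rfl,
          fun x => ?_⟩
        simp only [if_pos h1, if_neg h2, pow_add, pow_zero, mul_one, Complex.imLm_coe,
          Complex.mul_im, hab']
        ring
      · refine ⟨Complex.imLm, Complex.imLm, Or.inr ⟨rfl, rfl⟩, 1 / 2, 1 / 2,
          fun h => absurd h hab', fun x => ?_⟩
        simp only [if_pos h1, if_neg h2, pow_add, pow_zero, mul_one, ← map_pow, Complex.imLm_coe,
          Complex.mul_im, Complex.conj_re, Complex.conj_im]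
        ring
    · by_cases hab' : a = b
      · refine ⟨Complex.imLm, Complex.imLm, Or.inr ⟨rfl, rfl⟩, 1 / 2, 0, fun _ => rfl,
          fun x => ?_⟩
        simp only [if_neg h1, if_pos h2, pow_add, pow_zero, mul_one, Complex.imLm_coe,
          Complex.mul_im, hab']
        ring
      · refine ⟨Complex.imLm, Complex.imLm, Or.inr ⟨rfl, rfl⟩, 1 / 2, -1 / 2,
          fun h => absurd h hab', fun x => ?_⟩
        simp only [if_neg h1, if_pos h2, pow_add, pow_zero, mul_one, ← map_pow, Complex.imLm_coe,
          Complex.mul_im, Complex.conj_re, Complex.conj_im]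
        ring
    · refine ⟨Complex.reLm, Complex.reLm, Or.inl ⟨rfl, rfl⟩, 1 / 2, 1 / 2,
        fun h => by omega, fun x => ?_⟩
      simp only [if_neg h1, if_neg h2, pow_add, pow_zero, mul_one, ← map_pow, Complex.reLm_coe,
        Complex.mul_re, Complex.conj_re, Complex.conj_im]
      ring
  obtain ⟨f, g, hfg, c, d, hd, hx⟩ := hkey
  have hsplit : ∀ x : S2, q.eval (x.1 2) * (angularFactor m x * angularFactor m' x) =
      c * (q.eval (x.1 2) * f (horiz x ^ (a + b) * (starRingEnd ℂ) (horiz x) ^ 0)) +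
      d * (q.eval (x.1 2) * g (horiz x ^ a * (starRingEnd ℂ) (horiz x) ^ b)) := by
    intro x
    rw [hx]
    ring
  have hc1 := continuous_eval_coord_mul_re_im q (a + b) 0
  have hc2 := continuous_eval_coord_mul_re_im q a b
  have hz1 := integral_re_im_horiz q hab
  simp_rw [hsplit]
  by_cases hab' : a = b
  · rw [hd hab']
    simp only [zero_mul, add_zero]
    rw [integral_const_mul]
    rcases hfg with ⟨rfl, rfl⟩ | ⟨rfl, rfl⟩
    · exact mul_eq_zero_of_right _ hz1.1
    · exact mul_eq_zero_of_right _ hz1.2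
  · have hz2 := integral_re_im_horiz q hab'
    rcases hfg with ⟨rfl, rfl⟩ | ⟨rfl, rfl⟩
    · simp only [Complex.reLm_coe]
      rw [integral_add (hc1.1.integrable_unifS2.const_mul c) (hc2.1.integrable_unifS2.const_mul d),
        integral_const_mul, integral_const_mul, hz1.1, hz2.1]
      simp
    · simp only [Complex.imLm_coe]
      rw [integral_add (hc1.2.integrable_unifS2.const_mul c) (hc2.2.integrable_unifS2.const_mul d),
        integral_const_mul, integral_const_mul, hz1.2, hz2.2]
      simp

theorem re_sq_add_im_sq_horiz_pow (a : ℕ) (x : S2) :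
    (horiz x ^ a).re ^ 2 + (horiz x ^ a).im ^ 2 = (1 - x.1 2 ^ 2) ^ a := by
  have h := horiz_mul_conj x
  have h2 : horiz x ^ a * (starRingEnd ℂ) (horiz x ^ a) = (((1 - x.1 2 ^ 2) ^ a : ℝ) : ℂ) := by
    rw [map_pow, ← mul_pow, h]
    push_cast
    rfl
  rw [Complex.mul_conj, Complex.ofReal_inj, Complex.normSq_apply] at h2
  linarith

theorem integral_angularFactor_self (q : Polynomial ℝ) {m : ℤ} (hm : m ≠ 0) :
    ∫ x : S2, q.eval (x.1 2) * (angularFactor m x * angularFactor m x) ∂unifS2 =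
      intervalFunctional ((1 - Polynomial.X ^ 2) ^ m.natAbs * q) / 4 := by
  set a := m.natAbs with ha
  have hab : a + a ≠ 0 := by omega
  have hkey : ∃ c : ℝ, ∀ x, angularFactor m x * angularFactor m x =
      c * (horiz x ^ (a + a) * (starRingEnd ℂ) (horiz x) ^ 0).re +
        (1 / 2) * (1 - x.1 2 ^ 2) ^ a := by
    unfold angularFactor
    rw [← ha]
    by_cases h1 : m < 0
    · refine ⟨-1 / 2, fun x => ?_⟩
      rw [← re_sq_add_im_sq_horiz_pow]
      simp only [if_pos h1, pow_add, pow_zero, mul_one, Complex.mul_re]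
      ring
    · refine ⟨1 / 2, fun x => ?_⟩
      rw [← re_sq_add_im_sq_horiz_pow]
      simp only [if_neg h1, pow_add, pow_zero, mul_one, Complex.mul_re]
      ring
  obtain ⟨c, hx⟩ := hkey
  have hsplit : ∀ x : S2, q.eval (x.1 2) * (angularFactor m x * angularFactor m x) =
      c * (q.eval (x.1 2) * (horiz x ^ (a + a) * (starRingEnd ℂ) (horiz x) ^ 0).re) +
        (1 / 2) * ((1 - Polynomial.X ^ 2) ^ a * q).eval (x.1 2) := by
    intro x
    rw [hx]
    simp only [Polynomial.eval_mul, Polynomial.eval_pow, Polynomial.eval_sub, Polynomial.eval_one,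
      Polynomial.eval_X]
    ring
  have hc1 := (continuous_eval_coord_mul_re_im q (a + a) 0).1
  have hc2 : Continuous fun x : S2 => ((1 - Polynomial.X ^ 2) ^ a * q).eval (x.1 2) := by
    have := ((1 - Polynomial.X ^ 2) ^ a * q).continuous
    fun_prop
  simp_rw [hsplit]
  rw [integral_add (hc1.integrable_unifS2.const_mul c) (hc2.integrable_unifS2.const_mul _),
    integral_const_mul, integral_const_mul, (integral_re_im_horiz q hab).1, integral_eval_coord]
  ring

/-- The real spherical harmonics are orthonormal for the uniform probability measure. -/
theorem integral_sphericalHarmonic_mul {l l' : ℕ} {m m' : ℤ} (hm : m.natAbs ≤ l) :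
    ∫ x, sphericalHarmonic l m x * sphericalHarmonic l' m' x ∂unifS2 =
      if l = l' ∧ m = m' then 1 else 0 := by
  set u := Polynomial.derivative^[m.natAbs] (legendreP l) with hu
  set v := Polynomial.derivative^[m'.natAbs] (legendreP l') with hv
  have hsplit : ∀ x, sphericalHarmonic l m x * sphericalHarmonic l' m' x =
      (harmonicCoeff l m * harmonicCoeff l' m') *
        ((u * v).eval (x.1 2) * (angularFactor m x * angularFactor m' x)) := by
    intro x
    rw [sphericalHarmonic_eq, sphericalHarmonic_eq, Polynomial.eval_mul]
    ring
  simp_rw [hsplit]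
  rw [integral_const_mul]
  by_cases hmm : m = m'
  · subst hmm
    by_cases hm0 : m = 0
    · subst hm0
      have h1 : ∀ x : S2, (u * v).eval (x.1 2) * (angularFactor 0 x * angularFactor 0 x) =
          (u * v).eval (x.1 2) := fun x => by simp [angularFactor]
      simp_rw [h1]
      rw [integral_eval_coord]
      by_cases hl : l = l'
      · subst hl
        rw [if_pos (by simp), ← sq, harmonicCoeff_zero_sq]
        have h2 := intervalFunctional_legendre_self (Nat.zero_le l)
        rw [legendreRatio_zero, pow_zero, one_mul] at h2
        change _ * intervalFunctional (u * v) = 2 at h2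
        linear_combination h2 / 2
      · rw [if_neg (fun h => hl h.1)]
        have h2 := intervalFunctional_legendre_of_ne hl 0
        rw [pow_zero, one_mul] at h2
        change intervalFunctional (u * v) = 0 at h2
        rw [h2]
        simp
    · rw [integral_angularFactor_self _ hm0]
      by_cases hl : l = l'
      · subst hl
        rw [if_pos (by simp), ← sq, harmonicCoeff_sq hm0]
        have h2 := intervalFunctional_legendre_self hm
        linear_combination h2 / 2
      · rw [if_neg (fun h => hl h.1), intervalFunctional_legendre_of_ne hl m.natAbs]
        simp
  · rw [if_neg (fun h => hmm h.2), integral_angularFactor_of_ne _ hmm, mul_zero]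

theorem sum_Icc_neg_nat (f : ℤ → ℝ) (l : ℕ) :
    ∑ m ∈ Finset.Icc (-(l : ℤ)) l, f m =
      f 0 + ∑ m ∈ Finset.range l, (f ((m + 1 : ℕ) : ℤ) + f (-((m + 1 : ℕ) : ℤ))) := by
  induction l with
  | zero => simp
  | succ l ih =>
    have h : Finset.Icc (-((l + 1 : ℕ) : ℤ)) ((l + 1 : ℕ) : ℤ) =
        insert ((l + 1 : ℕ) : ℤ) (insert (-((l + 1 : ℕ) : ℤ)) (Finset.Icc (-(l : ℤ)) l)) := by
      ext m
      simp only [Finset.mem_Icc, Finset.mem_insert]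
      omega
    rw [h, Finset.sum_insert, Finset.sum_insert, ih, Finset.sum_range_succ]
    · ring
    · simp only [Finset.mem_Icc]
      omega
    · simp only [Finset.mem_Icc, Finset.mem_insert]
      omega

/-- The addition theorem on the diagonal. -/
theorem sum_sphericalHarmonic_sq (l : ℕ) (x : S2) :
    ∑ m ∈ Finset.Icc (-(l : ℤ)) l, sphericalHarmonic l m x ^ 2 = 2 * l + 1 := by
  rw [sum_Icc_neg_nat]
  have h0 : sphericalHarmonic l 0 x ^ 2 = (2 * l + 1) * (legendreP l).eval (x.1 2) ^ 2 := by
    rw [sphericalHarmonic_eq, mul_pow, mul_pow, harmonicCoeff_zero_sq]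
    simp [angularFactor]
  have h1 : ∀ m ∈ Finset.range l, sphericalHarmonic l ((m + 1 : ℕ) : ℤ) x ^ 2 +
      sphericalHarmonic l (-((m + 1 : ℕ) : ℤ)) x ^ 2 = (2 * l + 1) * (2 *
        (legendreRatio l (m + 1) * ((1 - x.1 2 ^ 2) ^ (m + 1) *
          (Polynomial.derivative^[m + 1] (legendreP l)).eval (x.1 2) ^ 2))) := by
    intro m _
    rw [sphericalHarmonic_eq, sphericalHarmonic_eq, mul_pow, mul_pow, mul_pow, mul_pow,
      harmonicCoeff_sq (by omega), harmonicCoeff_sq (by omega)]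
    unfold angularFactor
    rw [if_neg (by omega), if_pos (by omega), Int.natAbs_neg, Int.natAbs_natCast,
      ← re_sq_add_im_sq_horiz_pow]
    ring
  rw [h0, Finset.sum_congr rfl h1, ← Finset.mul_sum, ← Finset.mul_sum, ← mul_add]
  have h2 := congrArg (Polynomial.eval (x.1 2)) (sum_sq_legendre l)
  simp only [Polynomial.eval_add, Polynomial.eval_mul, Polynomial.eval_pow, Polynomial.eval_sub,
    Polynomial.eval_one, Polynomial.eval_X, Polynomial.eval_C, Polynomial.eval_finsetSum,
    Polynomial.eval_ofNat] at h2
  rw [h2, mul_one]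

/-! ### Spherical harmonics as polynomials -/

theorem exists_mvPolynomial_horiz_pow (a : ℕ) : ∃ p q : MvPolynomial (Fin 3) ℝ,
    p.totalDegree ≤ a ∧ q.totalDegree ≤ a ∧ ∀ x : S2,
      MvPolynomial.eval (fun i => x.1 i) p = (horiz x ^ a).re ∧
      MvPolynomial.eval (fun i => x.1 i) q = (horiz x ^ a).im := by
  induction a with
  | zero => exact ⟨1, 0, by simp, by simp, fun x => by simp⟩
  | succ a ih =>
    obtain ⟨p, q, hp, hq, h⟩ := ih
    have hX : ∀ i : Fin 3, (MvPolynomial.X i : MvPolynomial (Fin 3) ℝ).totalDegree ≤ 1 :=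
      fun i => (MvPolynomial.totalDegree_X i).le
    have hm : ∀ (r : MvPolynomial (Fin 3) ℝ) (i : Fin 3), r.totalDegree ≤ a →
        (r * MvPolynomial.X i).totalDegree ≤ a + 1 := fun r i hr =>
      (MvPolynomial.totalDegree_mul _ _).trans (add_le_add hr (hX i))
    refine ⟨p * MvPolynomial.X 0 - q * MvPolynomial.X 1,
      p * MvPolynomial.X 1 + q * MvPolynomial.X 0,
      (MvPolynomial.totalDegree_sub _ _).trans (max_le (hm _ _ hp) (hm _ _ hq)),
      (MvPolynomial.totalDegree_add _ _).trans (max_le (hm _ _ hp) (hm _ _ hq)), fun x => ?_⟩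
    have hre : (horiz x).re = x.1 0 := by simp [horiz]
    have him : (horiz x).im = x.1 1 := by simp [horiz]
    simp only [map_sub, map_add, map_mul, MvPolynomial.eval_X, (h x).1, (h x).2, pow_succ,
      Complex.mul_re, Complex.mul_im, hre, him]
    exact ⟨trivial, trivial⟩

theorem exists_mvPolynomial_eval_coord (p : Polynomial ℝ) : ∃ r : MvPolynomial (Fin 3) ℝ,
    r.totalDegree ≤ p.natDegree ∧ ∀ x : S2,
      MvPolynomial.eval (fun i => x.1 i) r = p.eval (x.1 2) := by
  refine ⟨∑ i ∈ Finset.range (p.natDegree + 1),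
    MvPolynomial.C (p.coeff i) * MvPolynomial.X 2 ^ i, ?_, fun x => ?_⟩
  · refine MvPolynomial.totalDegree_finsetSum_le fun i hi => ?_
    refine (MvPolynomial.totalDegree_mul _ _).trans ?_
    rw [MvPolynomial.totalDegree_C, MvPolynomial.totalDegree_X_pow, zero_add]
    exact Nat.lt_succ_iff.1 (Finset.mem_range.1 hi)
  · rw [Polynomial.eval_eq_sum_range, map_sum]
    simp

theorem exists_mvPolynomial_sphericalHarmonic {l : ℕ} {m : ℤ} (hm : m.natAbs ≤ l) :
    ∃ r : MvPolynomial (Fin 3) ℝ, r.totalDegree ≤ l ∧ ∀ x : S2,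
      MvPolynomial.eval (fun i => x.1 i) r = sphericalHarmonic l m x := by
  obtain ⟨p, q, hp, hq, hpq⟩ := exists_mvPolynomial_horiz_pow m.natAbs
  obtain ⟨r, hr, hr2⟩ :=
    exists_mvPolynomial_eval_coord (Polynomial.derivative^[m.natAbs] (legendreP l))
  have hr3 : r.totalDegree ≤ l - m.natAbs := hr.trans
    ((Polynomial.natDegree_iterate_derivative _ _).trans
      (Nat.sub_le_sub_right (natDegree_legendreP_le l) _))
  refine ⟨MvPolynomial.C (harmonicCoeff l m) * r * (if m < 0 then q else p), ?_, fun x => ?_⟩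
  · refine (MvPolynomial.totalDegree_mul _ _).trans ?_
    have h1 := MvPolynomial.totalDegree_mul (MvPolynomial.C (harmonicCoeff l m)) r
    rw [MvPolynomial.totalDegree_C, zero_add] at h1
    have h2 : (if m < 0 then q else p).totalDegree ≤ m.natAbs := by split_ifs <;> assumption
    omega
  · rw [sphericalHarmonic_eq, map_mul, map_mul, MvPolynomial.eval_C, hr2, angularFactor]
    split_ifs
    · rw [(hpq x).2]
    · rw [(hpq x).1]

/-! ### Norm bounds for needlets -/

/-- The indices of the spherical harmonics of degree at most `n`. -/
noncomputable def harmonicIndices (n : ℕ) : Finset (Σ _ : ℕ, ℤ) :=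
  (Finset.range (n + 1)).sigma fun l => Finset.Icc (-(l : ℤ)) l

theorem mem_harmonicIndices {n : ℕ} {p : Σ _ : ℕ, ℤ} :
    p ∈ harmonicIndices n ↔ p.1 ≤ n ∧ p.2.natAbs ≤ p.1 := by
  simp only [harmonicIndices, Finset.mem_sigma, Finset.mem_range, Finset.mem_Icc]
  omega

theorem sum_harmonicIndices_sq (n : ℕ) (x : S2) :
    ∑ p ∈ harmonicIndices n, sphericalHarmonic p.1 p.2 x ^ 2 = ((n : ℝ) + 1) ^ 2 := by
  rw [harmonicIndices, Finset.sum_sigma]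
  simp only [sum_sphericalHarmonic_sq]
  induction n with
  | zero => simp
  | succ n ih =>
    rw [Finset.sum_range_succ, ih]
    push_cast
    ring

theorem integral_sq_sum_sphericalHarmonic (n : ℕ) (a : (Σ _ : ℕ, ℤ) → ℝ) :
    ∫ x, (∑ p ∈ harmonicIndices n, a p * sphericalHarmonic p.1 p.2 x) ^ 2 ∂unifS2 =
      ∑ p ∈ harmonicIndices n, a p ^ 2 := by
  have hc : ∀ p q : Σ _ : ℕ, ℤ, Integrable (fun x =>
      a p * sphericalHarmonic p.1 p.2 x * (a q * sphericalHarmonic q.1 q.2 x)) unifS2 :=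
    fun p q => Continuous.integrable_unifS2 <| by
      have h1 := continuous_sphericalHarmonic p.1 p.2
      have h2 := continuous_sphericalHarmonic q.1 q.2
      fun_prop
  simp_rw [sq, Finset.sum_mul_sum]
  rw [integral_finsetSum _ fun p _ => integrable_finsetSum _ fun q _ => hc p q]
  refine Finset.sum_congr rfl fun p hp => ?_
  rw [integral_finsetSum _ fun q _ => hc p q, Finset.sum_eq_single p]
  · have h1 : ∀ x, a p * sphericalHarmonic p.1 p.2 x * (a p * sphericalHarmonic p.1 p.2 x) =
        (a p * a p) * (sphericalHarmonic p.1 p.2 x * sphericalHarmonic p.1 p.2 x) := fun x => by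
      ring
    simp_rw [h1]
    rw [integral_const_mul, integral_sphericalHarmonic_mul (mem_harmonicIndices.1 hp).2,
      if_pos ⟨rfl, rfl⟩, mul_one]
  · intro q _ hq
    have h1 : ∀ x, a p * sphericalHarmonic p.1 p.2 x * (a q * sphericalHarmonic q.1 q.2 x) =
        (a p * a q) * (sphericalHarmonic p.1 p.2 x * sphericalHarmonic q.1 q.2 x) := fun x => by
      ring
    simp_rw [h1]
    rw [integral_const_mul, integral_sphericalHarmonic_mul (mem_harmonicIndices.1 hp).2, if_neg,
      mul_zero]
    rintro ⟨h2, h3⟩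
    exact hq (Sigma.ext h2.symm (heq_of_eq h3.symm))
  · exact fun h => absurd hp h

theorem abs_sum_sphericalHarmonic_le (n : ℕ) (a : (Σ _ : ℕ, ℤ) → ℝ) (ha : ∀ p, |a p| ≤ 1)
    (x y : S2) : |∑ p ∈ harmonicIndices n,
      a p * sphericalHarmonic p.1 p.2 x * sphericalHarmonic p.1 p.2 y| ≤ ((n : ℝ) + 1) ^ 2 := by
  have h1 : ∀ p ∈ harmonicIndices n,
      |a p * sphericalHarmonic p.1 p.2 x * sphericalHarmonic p.1 p.2 y| ≤
      (sphericalHarmonic p.1 p.2 x ^ 2 + sphericalHarmonic p.1 p.2 y ^ 2) / 2 := by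
    intro p _
    rw [abs_mul, abs_mul, ← sq_abs (sphericalHarmonic p.1 p.2 x),
      ← sq_abs (sphericalHarmonic p.1 p.2 y)]
    have h2 := mul_le_mul_of_nonneg_right (ha p) (mul_nonneg
      (abs_nonneg (sphericalHarmonic p.1 p.2 x)) (abs_nonneg (sphericalHarmonic p.1 p.2 y)))
    nlinarith [sq_nonneg (|sphericalHarmonic p.1 p.2 x| - |sphericalHarmonic p.1 p.2 y|)]
  refine (Finset.abs_sum_le_sum_abs _ _).trans ((Finset.sum_le_sum h1).trans ?_)
  rw [← Finset.sum_div, Finset.sum_add_distrib, sum_harmonicIndices_sq, sum_harmonicIndices_sq]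
  linarith

namespace NeedletSystem

variable (𝒩 : NeedletSystem)

theorem B_pos : 0 < 𝒩.B := one_pos.trans 𝒩.one_lt_B

/-- The weight of a cubature point is bounded by testing the cubature formula on the square of the
reproducing kernel centred at that point. -/
theorem wt_mul_sq_le (j : ℕ) (k : Fin (𝒩.K j)) :
    𝒩.wt j k * ((⌊𝒩.B ^ (j + 1)⌋₊ : ℝ) + 1) ^ 2 ≤ 1 := by
  set n := ⌊𝒩.B ^ (j + 1)⌋₊ with hn
  have hex : ∀ p : Σ _ : ℕ, ℤ, ∃ r : MvPolynomial (Fin 3) ℝ, p ∈ harmonicIndices n →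
      r.totalDegree ≤ n ∧ ∀ x : S2,
        MvPolynomial.eval (fun i => x.1 i) r = sphericalHarmonic p.1 p.2 x := by
    intro p
    by_cases hp : p ∈ harmonicIndices n
    · obtain ⟨r, hr, hr2⟩ := exists_mvPolynomial_sphericalHarmonic (mem_harmonicIndices.1 hp).2
      exact ⟨r, fun _ => ⟨hr.trans (mem_harmonicIndices.1 hp).1, hr2⟩⟩
    · exact ⟨0, fun h => absurd h hp⟩
  choose r hr using hex
  set a : (Σ _ : ℕ, ℤ) → ℝ := fun p => sphericalHarmonic p.1 p.2 (𝒩.ξ j k) with ha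
  set Q : MvPolynomial (Fin 3) ℝ := ∑ p ∈ harmonicIndices n, MvPolynomial.C (a p) * r p with hQ
  have hQd : Q.totalDegree ≤ n := by
    refine MvPolynomial.totalDegree_finsetSum_le fun p hp => ?_
    refine (MvPolynomial.totalDegree_mul _ _).trans ?_
    rw [MvPolynomial.totalDegree_C, zero_add]
    exact (hr p hp).1
  have hQe : ∀ x : S2, MvPolynomial.eval (fun i => x.1 i) Q =
      ∑ p ∈ harmonicIndices n, a p * sphericalHarmonic p.1 p.2 x := by
    intro x
    rw [hQ, map_sum]
    refine Finset.sum_congr rfl fun p hp => ?_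
    rw [map_mul, MvPolynomial.eval_C, (hr p hp).2]
  have hcub := 𝒩.exact_quadrature j (Q ^ 2)
    ((MvPolynomial.totalDegree_pow _ _).trans (Nat.mul_le_mul_left 2 hQd))
  simp only [map_pow, hQe] at hcub
  rw [integral_sq_sum_sphericalHarmonic, sum_harmonicIndices_sq] at hcub
  have hk : 𝒩.wt j k * (((n : ℝ) + 1) ^ 2) ^ 2 ≤ ((n : ℝ) + 1) ^ 2 := by
    refine le_trans (le_of_eq ?_) (le_trans (Finset.single_le_sum (f := fun k' => 𝒩.wt j k' *
      (∑ p ∈ harmonicIndices n, a p * sphericalHarmonic p.1 p.2 (𝒩.ξ j k')) ^ 2)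
      (fun k' _ => mul_nonneg (𝒩.wt_pos j k').le (sq_nonneg _)) (Finset.mem_univ k)) hcub.ge)
    rw [← sum_harmonicIndices_sq n (𝒩.ξ j k)]
    simp only [ha, sq]
  have hpos : 0 < ((n : ℝ) + 1) ^ 2 := by positivity
  rw [sq (((n : ℝ) + 1) ^ 2), ← mul_assoc] at hk
  exact le_of_mul_le_mul_right (by rwa [one_mul]) hpos

theorem abs_b_le_one (l j : ℕ) : |𝒩.b (l / 𝒩.B ^ j)| ≤ 1 := by
  rcases Nat.eq_zero_or_pos l with rfl | hl
  · -- the partition of unity says nothing at `0`, which lies outside the support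
    have h : 𝒩.b 0 = 0 := by
      by_contra h
      have h1 := (𝒩.b_support (Function.mem_support.2 h)).1
      exact absurd h1 (not_le.2 (inv_pos.2 𝒩.B_pos))
    simp [h]
  · have h := le_hasSum (𝒩.b_partition l hl) j fun i _ => sq_nonneg _
    rw [← one_pow 2] at h
    exact abs_le_of_sq_le_sq h zero_le_one

/-- The coefficient of `Y_{ℓ,m}(ξ) Y_{ℓ,m}` in a needlet of resolution `j`. -/
noncomputable def window (j : ℕ) (p : Σ _ : ℕ, ℤ) : ℝ :=
  if p.1 ∈ 𝒩.multipoles j then 𝒩.b (p.1 / 𝒩.B ^ j) else 0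

theorem abs_window_le_one (j : ℕ) (p : Σ _ : ℕ, ℤ) : |𝒩.window j p| ≤ 1 := by
  unfold window
  split_ifs
  · exact 𝒩.abs_b_le_one _ _
  · simp

theorem psi_eq_sum (j : ℕ) (k : Fin (𝒩.K j)) (x : S2) :
    𝒩.psi j k x = Real.sqrt (𝒩.wt j k) * ∑ p ∈ harmonicIndices ⌊𝒩.B ^ (j + 1)⌋₊,
      𝒩.window j p * sphericalHarmonic p.1 p.2 (𝒩.ξ j k) * sphericalHarmonic p.1 p.2 x := by
  unfold psi
  congr 1
  rw [harmonicIndices, Finset.sum_sigma]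
  have hsub : 𝒩.multipoles j ⊆ Finset.range (⌊𝒩.B ^ (j + 1)⌋₊ + 1) := by
    intro l hl
    exact Finset.mem_range.2 (Nat.lt_succ_of_le (Finset.mem_Icc.1 hl).2)
  rw [← Finset.sum_subset hsub]
  · refine Finset.sum_congr rfl fun l hl => ?_
    rw [Finset.mul_sum]
    refine Finset.sum_congr rfl fun m _ => ?_
    simp only [window, if_pos hl]
    ring
  · intro l _ hl
    refine Finset.sum_eq_zero fun m _ => ?_
    simp only [window, if_neg hl]
    ring

theorem continuous_psi (j : ℕ) (k : Fin (𝒩.K j)) : Continuous (𝒩.psi j k) := by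
  unfold psi
  have h := continuous_sphericalHarmonic
  fun_prop

theorem integral_psi_sq_le_one (j : ℕ) (k : Fin (𝒩.K j)) :
    ∫ x, 𝒩.psi j k x ^ 2 ∂unifS2 ≤ 1 := by
  simp_rw [psi_eq_sum, mul_pow]
  rw [integral_const_mul, integral_sq_sum_sphericalHarmonic, Real.sq_sqrt (𝒩.wt_pos j k).le]
  refine le_trans ?_ (𝒩.wt_mul_sq_le j k)
  refine mul_le_mul_of_nonneg_left ?_ (𝒩.wt_pos j k).le
  rw [← sum_harmonicIndices_sq _ (𝒩.ξ j k)]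
  refine Finset.sum_le_sum fun p _ => ?_
  rw [mul_pow]
  refine mul_le_of_le_one_left (sq_nonneg _) ?_
  rw [← sq_abs]
  exact pow_le_one₀ (abs_nonneg _) (𝒩.abs_window_le_one j p)

theorem abs_psi_le (j : ℕ) (k : Fin (𝒩.K j)) (x : S2) :
    |𝒩.psi j k x| ≤ 2 * 𝒩.B * 𝒩.B ^ j := by
  set n := ⌊𝒩.B ^ (j + 1)⌋₊ with hn
  have hB : 1 ≤ 𝒩.B ^ (j + 1) := one_le_pow₀ 𝒩.one_lt_B.le
  have hn1 : (n : ℝ) ≤ 𝒩.B ^ (j + 1) := Nat.floor_le (zero_le_one.trans hB)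
  have hn0 : (0 : ℝ) < n + 1 := by positivity
  rw [psi_eq_sum, abs_mul, abs_of_nonneg (Real.sqrt_nonneg _)]
  have h1 : Real.sqrt (𝒩.wt j k) * ((n : ℝ) + 1) ≤ 1 := by
    rw [← Real.sqrt_sq hn0.le, ← Real.sqrt_mul (𝒩.wt_pos j k).le]
    exact Real.sqrt_le_one.2 (𝒩.wt_mul_sq_le j k)
  calc Real.sqrt (𝒩.wt j k) * _
      ≤ Real.sqrt (𝒩.wt j k) * ((n : ℝ) + 1) ^ 2 :=
        mul_le_mul_of_nonneg_left
          (abs_sum_sphericalHarmonic_le n _ (𝒩.abs_window_le_one j) _ _) (Real.sqrt_nonneg _)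
    _ = (Real.sqrt (𝒩.wt j k) * ((n : ℝ) + 1)) * ((n : ℝ) + 1) := by ring
    _ ≤ 1 * ((n : ℝ) + 1) := mul_le_mul_of_nonneg_right h1 hn0.le
    _ ≤ 2 * 𝒩.B ^ (j + 1) := by linarith
    _ = 2 * 𝒩.B * 𝒩.B ^ j := by ring

theorem eLpNorm_psi (j : ℕ) (k : Fin (𝒩.K j)) :
    eLpNorm (𝒩.psi j k) 2 unifS2 =
      ENNReal.ofReal (Real.sqrt (∫ x, 𝒩.psi j k x ^ 2 ∂unifS2)) := by
  have hm : MemLp (𝒩.psi j k) 2 unifS2 :=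
    (memLp_two_iff_integrable_sq (𝒩.continuous_psi j k).aestronglyMeasurable).2
      ((𝒩.continuous_psi j k).pow 2).integrable_unifS2
  rw [hm.eLpNorm_eq_integral_rpow_norm (by norm_num) (by norm_num), Real.sqrt_eq_rpow]
  simp

theorem normBounds : 𝒩.NormBounds 1 (2 * 𝒩.B) where
  pos_two := one_pos
  pos_inf := mul_pos two_pos 𝒩.B_pos
  two_le j k := by
    rw [eLpNorm_psi]
    exact ENNReal.ofReal_le_ofReal (Real.sqrt_le_one.2 (𝒩.integral_psi_sq_le_one j k))
  inf_le := 𝒩.abs_psi_le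

variable {𝒩} in
theorem NormBounds.integral_psi_sq_le {C₂ Cinf : ℝ} (h : 𝒩.NormBounds C₂ Cinf) (j : ℕ)
    (k : Fin (𝒩.K j)) : ∫ x, 𝒩.psi j k x ^ 2 ∂unifS2 ≤ C₂ ^ 2 := by
  have h1 := h.two_le j k
  rw [eLpNorm_psi, ENNReal.ofReal_le_ofReal_iff h.pos_two.le] at h1
  exact (Real.sqrt_le_left h.pos_two.le).1 h1

end NeedletSystem

/-! ### Exponential moments of sample means -/

theorem Real.exp_le_one_add_add_sq_mul_exp_abs (x : ℝ) :
    Real.exp x ≤ 1 + x + x ^ 2 * Real.exp |x| := by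
  have h := Complex.norm_exp_sub_sum_le_norm_mul_exp (x : ℂ) 2
  rw [Finset.sum_range_succ, Finset.sum_range_one] at h
  have h2 : Complex.exp x - ((x : ℂ) ^ 0 / (Nat.factorial 0 : ℂ) +
      (x : ℂ) ^ 1 / (Nat.factorial 1 : ℂ)) = ((Real.exp x - (1 + x) : ℝ) : ℂ) := by
    push_cast
    simp
  rw [h2, Complex.norm_real, Complex.norm_real, Real.norm_eq_abs, Real.norm_eq_abs, sq_abs] at h
  linarith [le_abs_self (Real.exp x - (1 + x))]

/-- Below half the radius of exponential integrability, the quadratic remainder of `exp (b y)` is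
controlled by `exp |y|`. -/
theorem Real.exp_mul_le_of_abs_le_half {b : ℝ} (hb : |b| ≤ 1 / 2) (y : ℝ) :
    Real.exp (b * y) ≤ 1 + b * y + 8 * b ^ 2 * (Real.exp y + Real.exp (-y)) := by
  refine (Real.exp_le_one_add_add_sq_mul_exp_abs (b * y)).trans ?_
  have h1 : |b * y| ≤ |y| / 2 := by
    rw [abs_mul]
    nlinarith [abs_nonneg y]
  have h2 : y ^ 2 ≤ 8 * Real.exp (|y| / 2) := by
    have h := Real.quadratic_le_exp_of_nonneg (x := |y| / 2) (by positivity)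
    nlinarith [sq_abs y, abs_nonneg y]
  have h3 : Real.exp |y| ≤ Real.exp y + Real.exp (-y) := by
    rcases abs_cases y with ⟨h, _⟩ | ⟨h, _⟩ <;> rw [h] <;>
      linarith [Real.exp_pos y, Real.exp_pos (-y)]
  have h4 : (b * y) ^ 2 * Real.exp |b * y| ≤ 8 * b ^ 2 * Real.exp |y| := by
    calc (b * y) ^ 2 * Real.exp |b * y| ≤ (b * y) ^ 2 * Real.exp (|y| / 2) := by gcongr
      _ = b ^ 2 * (y ^ 2 * Real.exp (|y| / 2)) := by ring
      _ ≤ b ^ 2 * (8 * Real.exp (|y| / 2) * Real.exp (|y| / 2)) := by gcongr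
      _ = 8 * b ^ 2 * (Real.exp (|y| / 2) * Real.exp (|y| / 2)) := by ring
      _ = 8 * b ^ 2 * Real.exp |y| := by rw [← Real.exp_add, add_halves]
  have h5 : 8 * b ^ 2 * Real.exp |y| ≤ 8 * b ^ 2 * (Real.exp y + Real.exp (-y)) := by gcongr
  linarith

theorem Real.exp_le_of_abs_lt_one {x : ℝ} (hx : |x| < 1) :
    Real.exp x ≤ 1 + x + x ^ 2 / (2 * (1 - |x|)) := by
  have h := Real.exp_bound hx.le (n := 3) (by norm_num)
  rw [Finset.sum_range_succ, Finset.sum_range_succ, Finset.sum_range_one] at h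
  norm_num [Nat.factorial] at h
  have h1 := (abs_le.1 h).2
  have h2 : x ^ 2 / 2 * (1 + |x|) ≤ x ^ 2 / (2 * (1 - |x|)) := by
    rw [le_div_iff₀ (by linarith)]
    nlinarith [sq_nonneg x, sq_nonneg (x * |x|), abs_nonneg x]
  have h3 : |x| ^ 3 = x ^ 2 * |x| := by rw [← sq_abs x]; ring
  rw [h3] at h1
  nlinarith [mul_nonneg (sq_nonneg x) (abs_nonneg x)]

section ExpMoments

variable {Ω : Type*} [MeasurableSpace Ω] {P : Measure Ω} [IsProbabilityMeasure P]

theorem integrable_of_abs_le {f : Ω → ℝ} (hf : Measurable f) {M : ℝ} (hM : ∀ ω, |f ω| ≤ M) :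
    Integrable f P :=
  Integrable.of_bound hf.aestronglyMeasurable M (ae_of_all _ hM)

/-- Exponential moment of a product of a small bounded variable and an independent variable with
two exponential moments. -/
theorem integral_exp_mul_indep_le {α : Type*} [MeasurableSpace α] {X : Ω → α} {η : Ω → ℝ}
    (hX : Measurable X) (hη : Measurable η) (hind : IndepFun X η P)
    (hint : Integrable (fun ω => Real.exp (η ω) + Real.exp (-η ω)) P)
    (hη4 : ∫ ω, (Real.exp (η ω) + Real.exp (-η ω)) ∂P ≤ 4)
    {a : α → ℝ} (ha : Measurable a) (ha2 : ∀ x, |a x| ≤ 1 / 2) :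
    Integrable (fun ω => Real.exp (a (X ω) * η ω)) P ∧
    ∫ ω, Real.exp (a (X ω) * η ω) ∂P ≤
      Real.exp (∫ ω, a (X ω) * η ω ∂P + 32 * ∫ ω, a (X ω) ^ 2 ∂P) := by
  have haX : Measurable fun ω => a (X ω) := ha.comp hX
  have hexp : ∀ y : ℝ, |y| ≤ Real.exp y + Real.exp (-y) := fun y => by
    rcases abs_cases y with ⟨h, _⟩ | ⟨h, _⟩ <;> rw [h] <;>
      linarith [Real.add_one_le_exp y, Real.add_one_le_exp (-y), Real.exp_pos y,
        Real.exp_pos (-y)]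
  have hexp2 : ∀ y : ℝ, Real.exp |y| ≤ Real.exp y + Real.exp (-y) := fun y => by
    rcases abs_cases y with ⟨h, _⟩ | ⟨h, _⟩ <;> rw [h] <;>
      linarith [Real.exp_pos y, Real.exp_pos (-y)]
  have hi1 : Integrable (fun ω => Real.exp (a (X ω) * η ω)) P := by
    refine hint.mono' (by fun_prop) (ae_of_all _ fun ω => ?_)
    rw [Real.norm_eq_abs, abs_of_pos (Real.exp_pos _)]
    refine le_trans (Real.exp_le_exp.2 ?_) (hexp2 (η ω))
    refine (le_abs_self _).trans ?_
    rw [abs_mul]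
    nlinarith [ha2 (X ω), abs_nonneg (η ω)]
  have hi2 : Integrable (fun ω => a (X ω) * η ω) P := by
    refine hint.mono' (by fun_prop) (ae_of_all _ fun ω => ?_)
    rw [Real.norm_eq_abs, abs_mul]
    refine le_trans ?_ (hexp (η ω))
    nlinarith [ha2 (X ω), abs_nonneg (η ω)]
  have hind2 : IndepFun (fun ω => a (X ω) ^ 2) (fun ω => Real.exp (η ω) + Real.exp (-η ω)) P :=
    hind.comp (φ := fun x => a x ^ 2) (ψ := fun y => Real.exp y + Real.exp (-y))
      (by fun_prop) (by fun_prop)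
  have hia : Integrable (fun ω => a (X ω) ^ 2) P :=
    integrable_of_abs_le (M := (1 / 2) ^ 2) (by fun_prop) fun ω => by
      rw [abs_pow]
      exact pow_le_pow_left₀ (abs_nonneg _) (ha2 _) 2
  have hi3 : Integrable (fun ω => a (X ω) ^ 2 * (Real.exp (η ω) + Real.exp (-η ω))) P :=
    hind2.integrable_mul hia hint
  have hmul : ∫ ω, a (X ω) ^ 2 * (Real.exp (η ω) + Real.exp (-η ω)) ∂P =
      (∫ ω, a (X ω) ^ 2 ∂P) * ∫ ω, (Real.exp (η ω) + Real.exp (-η ω)) ∂P :=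
    hind2.integral_fun_mul_eq_mul_integral hia.aestronglyMeasurable hint.aestronglyMeasurable
  refine ⟨hi1, ?_⟩
  have hle : ∫ ω, Real.exp (a (X ω) * η ω) ∂P ≤ ∫ ω, (1 + a (X ω) * η ω +
      8 * (a (X ω) ^ 2 * (Real.exp (η ω) + Real.exp (-η ω)))) ∂P := by
    refine integral_mono hi1 (((integrable_const 1).add hi2).add (hi3.const_mul 8)) fun ω => ?_
    have := Real.exp_mul_le_of_abs_le_half (ha2 (X ω)) (η ω)
    simp only
    linarith
  have hi12 : Integrable (fun ω => 1 + a (X ω) * η ω) P := (integrable_const 1).add hi2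
  rw [integral_add hi12 (hi3.const_mul 8), integral_add (integrable_const 1) hi2,
    integral_const_mul, hmul] at hle
  simp only [integral_const, probReal_univ, smul_eq_mul, mul_one] at hle
  have hnn : 0 ≤ ∫ ω, a (X ω) ^ 2 ∂P := integral_nonneg fun ω => sq_nonneg _
  refine hle.trans (le_trans ?_ (Real.add_one_le_exp _))
  nlinarith [mul_le_mul_of_nonneg_left hη4 hnn]

/-- Bernstein's exponential moment bound for a bounded variable. -/
theorem integral_exp_mul_bounded_le {Y : Ω → ℝ} (hY : Measurable Y) {M V t : ℝ}
    (hM : ∀ ω, |Y ω| ≤ M) (hV : ∫ ω, Y ω ^ 2 ∂P ≤ V) (ht : |t| * M < 1) :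
    Integrable (fun ω => Real.exp (t * Y ω)) P ∧
    ∫ ω, Real.exp (t * Y ω) ∂P ≤
      Real.exp (t * ∫ ω, Y ω ∂P + t ^ 2 * V / (2 * (1 - |t| * M))) := by
  have hle1 : ∀ ω, |t * Y ω| ≤ |t| * M := fun ω => by
    rw [abs_mul]
    exact mul_le_mul_of_nonneg_left (hM ω) (abs_nonneg t)
  have hi1 : Integrable (fun ω => Real.exp (t * Y ω)) P :=
    integrable_of_abs_le (M := Real.exp (|t| * M)) (by fun_prop) fun ω => by
      rw [abs_of_pos (Real.exp_pos _)]
      exact Real.exp_le_exp.2 ((le_abs_self _).trans (hle1 ω))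
  have hi2 : Integrable Y P := integrable_of_abs_le hY hM
  have hi3 : Integrable (fun ω => Y ω ^ 2) P :=
    integrable_of_abs_le (M := M ^ 2) (by fun_prop) fun ω => by
      rw [abs_pow]
      exact pow_le_pow_left₀ (abs_nonneg _) (hM ω) 2
  have hpos : 0 < 2 * (1 - |t| * M) := by linarith
  refine ⟨hi1, ?_⟩
  have hle : ∫ ω, Real.exp (t * Y ω) ∂P ≤
      ∫ ω, (1 + t * Y ω + t ^ 2 / (2 * (1 - |t| * M)) * Y ω ^ 2) ∂P := by
    refine integral_mono hi1 (((integrable_const 1).add (hi2.const_mul t)).add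
      (hi3.const_mul _)) fun ω => ?_
    refine (Real.exp_le_of_abs_lt_one ((hle1 ω).trans_lt ht)).trans ?_
    have h2 : (t * Y ω) ^ 2 / (2 * (1 - |t * Y ω|)) ≤ (t * Y ω) ^ 2 / (2 * (1 - |t| * M)) := by
      gcongr
      exact hle1 ω
    have h3 : (t * Y ω) ^ 2 / (2 * (1 - |t| * M)) =
        t ^ 2 / (2 * (1 - |t| * M)) * Y ω ^ 2 := by ring
    linarith
  have hi12 : Integrable (fun ω => 1 + t * Y ω) P := (integrable_const 1).add (hi2.const_mul t)
  rw [integral_add hi12 (hi3.const_mul _),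
    integral_add (integrable_const 1) (hi2.const_mul t), integral_const_mul,
    integral_const_mul] at hle
  simp only [integral_const, probReal_univ, smul_eq_mul, mul_one] at hle
  refine hle.trans (le_trans ?_ (Real.add_one_le_exp _))
  have h4 : t ^ 2 / (2 * (1 - |t| * M)) * ∫ ω, Y ω ^ 2 ∂P ≤
      t ^ 2 / (2 * (1 - |t| * M)) * V :=
    mul_le_mul_of_nonneg_left hV (div_nonneg (sq_nonneg _) hpos.le)
  have h5 : t ^ 2 / (2 * (1 - |t| * M)) * V = t ^ 2 * V / (2 * (1 - |t| * M)) := by ring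
  linarith

/-- The deviation of the sample mean of the `Z i` from `m`. -/
noncomputable def sampleError {N : ℕ} (Z : Fin N → Ω → ℝ) (m : ℝ) (ω : Ω) : ℝ :=
  (1 / (N : ℝ)) * ∑ i, Z i ω - m

theorem measurable_sampleError {N : ℕ} {Z : Fin N → Ω → ℝ} (hZ : ∀ i, Measurable (Z i)) (m : ℝ) :
    Measurable (sampleError Z m) := by
  unfold sampleError
  fun_prop

theorem integral_exp_sampleError_le {N : ℕ} (hN : 0 < N) {Z : Fin N → Ω → ℝ}
    (hZ : ∀ i, Measurable (Z i)) (hind : iIndepFun Z P) {t m q : ℝ}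
    (h : ∀ i, Integrable (fun ω => Real.exp (t * Z i ω)) P ∧
      ∫ ω, Real.exp (t * Z i ω) ∂P ≤ Real.exp (t * m + q)) :
    Integrable (fun ω => Real.exp (t * N * sampleError Z m ω)) P ∧
    ∫ ω, Real.exp (t * N * sampleError Z m ω) ∂P ≤ Real.exp (N * q) := by
  have hN' : (N : ℝ) ≠ 0 := by positivity
  have hrw : ∀ ω, Real.exp (t * N * sampleError Z m ω) =
      Real.exp (-(N * (t * m))) * Real.exp (t * (∑ i, Z i) ω) := by
    intro ω
    rw [← Real.exp_add, sampleError, Finset.sum_apply]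
    congr 1
    field_simp
    ring
  simp_rw [hrw]
  have hi := hind.integrable_exp_mul_sum (s := Finset.univ) hZ fun i _ => (h i).1
  have hm := hind.mgf_sum hZ Finset.univ (t := t)
  refine ⟨hi.const_mul _, ?_⟩
  rw [integral_const_mul]
  have h2 : ∫ ω, Real.exp (t * (∑ i, Z i) ω) ∂P ≤ Real.exp (t * m + q) ^ N := by
    change mgf (∑ i, Z i) P t ≤ _
    rw [hm]
    calc ∏ i, mgf (Z i) P t ≤ ∏ _i : Fin N, Real.exp (t * m + q) :=
          Finset.prod_le_prod (fun i _ => mgf_nonneg) fun i _ => (h i).2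
      _ = _ := by simp
  refine (mul_le_mul_of_nonneg_left h2 (Real.exp_pos _).le).trans (le_of_eq ?_)
  rw [← Real.exp_nat_mul, ← Real.exp_add]
  congr 1
  ring

/-- Two-sided Chernoff bound. -/
theorem measureReal_abs_ge_le_two_mul_exp {Y : Ω → ℝ} {u t L : ℝ} (hu : 0 ≤ u)
    (h1 : Integrable (fun ω => Real.exp (u * Y ω)) P ∧
      ∫ ω, Real.exp (u * Y ω) ∂P ≤ Real.exp L)
    (h2 : Integrable (fun ω => Real.exp (-u * Y ω)) P ∧
      ∫ ω, Real.exp (-u * Y ω) ∂P ≤ Real.exp L) (hut : 2 * L ≤ u * t) :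
    P.real {ω | t ≤ |Y ω|} ≤ 2 * Real.exp (-L) := by
  have hsub : {ω | t ≤ |Y ω|} ⊆ {ω | t ≤ Y ω} ∪ {ω | t ≤ (-Y) ω} := by
    intro ω hω
    simpa [le_abs] using hω
  have hb : Real.exp (-u * t) * Real.exp L ≤ Real.exp (-L) := by
    rw [← Real.exp_add]
    exact Real.exp_le_exp.2 (by linarith)
  have hp1 := measure_ge_le_exp_mul_mgf (μ := P) (X := Y) t hu h1.1
  have hi2 : Integrable (fun ω => Real.exp (u * (-Y) ω)) P := by
    convert h2.1 using 3
    simp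
  have hp2 := measure_ge_le_exp_mul_mgf (μ := P) (X := -Y) t hu hi2
  rw [mgf_neg] at hp2
  have hp3 : P.real {ω | t ≤ Y ω} ≤ Real.exp (-L) :=
    hp1.trans ((mul_le_mul_of_nonneg_left h1.2 (Real.exp_pos _).le).trans hb)
  have hp4 : P.real {ω | t ≤ (-Y) ω} ≤ Real.exp (-L) :=
    hp2.trans ((mul_le_mul_of_nonneg_left h2.2 (Real.exp_pos _).le).trans hb)
  calc P.real {ω | t ≤ |Y ω|} ≤ P.real ({ω | t ≤ Y ω} ∪ {ω | t ≤ (-Y) ω}) := measureReal_mono hsub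
    _ ≤ P.real {ω | t ≤ Y ω} + P.real {ω | t ≤ (-Y) ω} := measureReal_union_le _ _
    _ ≤ 2 * Real.exp (-L) := by linarith

end ExpMoments

/-! ### The errors of the regression model -/

section Model

variable {Ω : Type*} [MeasurableSpace Ω] {P : Measure Ω}

theorem exists_lt_of_psi2Norm_lt {Z : Ω → ℝ} {c : ℝ} (h : psi2Norm Z P < ENNReal.ofReal c) :
    ∃ t : ℝ, 0 < t ∧ t < c ∧ ∫⁻ ω, ENNReal.ofReal (Real.exp (Z ω ^ 2 / t ^ 2)) ∂P ≤ 2 := by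
  unfold psi2Norm at h
  obtain ⟨t, h⟩ := iInf_lt_iff.1 h
  obtain ⟨ht, h⟩ := iInf_lt_iff.1 h
  obtain ⟨h2, h⟩ := iInf_lt_iff.1 h
  exact ⟨t, ht, (ENNReal.ofReal_lt_ofReal_iff_of_nonneg ht.le).1 h, h2⟩

theorem integrable_exp_sq_div {Z : Ω → ℝ} (hZ : Measurable Z) {t : ℝ}
    (h : ∫⁻ ω, ENNReal.ofReal (Real.exp (Z ω ^ 2 / t ^ 2)) ∂P ≤ 2) :
    Integrable (fun ω => Real.exp (Z ω ^ 2 / t ^ 2)) P ∧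
      ∫ ω, Real.exp (Z ω ^ 2 / t ^ 2) ∂P ≤ 2 := by
  have hm : Measurable fun ω => Real.exp (Z ω ^ 2 / t ^ 2) := by fun_prop
  have hnn : 0 ≤ᵐ[P] fun ω => Real.exp (Z ω ^ 2 / t ^ 2) := ae_of_all _ fun ω => (Real.exp_pos _).le
  refine ⟨(lintegral_ofReal_ne_top_iff_integrable hm.aestronglyMeasurable hnn).1
    (h.trans_lt (by simp)).ne, ?_⟩
  rw [integral_eq_lintegral_of_nonneg_ae hnn hm.aestronglyMeasurable]
  exact ENNReal.toReal_le_of_le_ofReal two_pos.le (by simpa using h)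

namespace IsDesign

variable {N : ℕ} {X : Fin N → Ω → S2} {ε : Fin N → Ω → ℝ} {s K : ℝ≥0}

theorem integral_map_X (h : IsDesign P X ε s K) (i : Fin N) {f : S2 → ℝ} (hf : Measurable f) :
    ∫ ω, f (X i ω) ∂P = ∫ x, f x ∂unifS2 := by
  rw [← h.map_X i, integral_map (h.measurable_X i).aemeasurable hf.aestronglyMeasurable]

theorem s_pos (h : IsDesign P X ε s K) (i : Fin N) : 0 < (s : ℝ) := by
  rcases eq_or_ne s 0 with rfl | hs
  · have h1 := h.subgaussian_ε i
    rw [zero_pow two_ne_zero] at h1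
    have h2 := h1.ae_eq_zero_of_hasSubgaussianMGF_zero
    have h3 : ∫ ω, ε i ω ^ 2 ∂P = 0 := by
      rw [integral_congr_ae (g := fun _ => 0)]
      · simp
      · filter_upwards [h2] with ω hω
        simp [hω]
    rw [h.var_ε i] at h3
    exact absurd h3 one_ne_zero
  · exact_mod_cast pos_iff_ne_zero.2 hs

theorem K_pos [IsProbabilityMeasure P] (h : IsDesign P X ε s K) (i : Fin N) : 0 < (K : ℝ) := by
  rcases eq_or_ne K 0 with rfl | hK
  · have h1 : psi2Norm (ε i) P < ENNReal.ofReal 1 := (h.orlicz_ε i).trans_lt (by simp)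
    obtain ⟨t, ht0, ht1, ht⟩ := exists_lt_of_psi2Norm_lt h1
    obtain ⟨hi, hle⟩ := integrable_exp_sq_div (h.measurable_ε i) ht
    have ht2 : 0 < t ^ 2 := by positivity
    -- `E ε² / t² ≤ E exp (ε² / t²) - 1 ≤ 1`, which contradicts `E ε² = 1` for `t < 1`
    have hsq : Integrable (fun ω => ε i ω ^ 2 / t ^ 2) P :=
      hi.mono' (((h.measurable_ε i).pow_const 2).div_const _).aestronglyMeasurable
        (ae_of_all _ fun ω => by
          rw [Real.norm_eq_abs, abs_of_nonneg (by positivity)]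
          linarith [Real.add_one_le_exp (ε i ω ^ 2 / t ^ 2)])
    have h2 : ∫ ω, (ε i ω ^ 2 / t ^ 2 + 1) ∂P ≤ ∫ ω, Real.exp (ε i ω ^ 2 / t ^ 2) ∂P :=
      integral_mono (hsq.add (integrable_const 1)) hi fun ω => Real.add_one_le_exp _
    rw [integral_add hsq (integrable_const 1), integral_div, h.var_ε i] at h2
    simp only [integral_const, probReal_univ, smul_eq_mul, mul_one] at h2
    have h3 : 1 / t ^ 2 ≤ 1 := by linarith
    rw [div_le_one ht2] at h3
    nlinarith
  · exact_mod_cast pos_iff_ne_zero.2 hK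

/-- The errors rescaled by their variance proxy have exponential moments bounded by an absolute
constant. -/
theorem exp_moments_div (h : IsDesign P X ε s K) (i : Fin N) :
    Integrable (fun ω => Real.exp (ε i ω / s) + Real.exp (-(ε i ω / s))) P ∧
      ∫ ω, (Real.exp (ε i ω / s) + Real.exp (-(ε i ω / s))) ∂P ≤ 4 := by
  have hs := h.s_pos i
  have hsub := h.subgaussian_ε i
  have e1 : ∀ ω, Real.exp (ε i ω / s) = Real.exp ((1 / (s : ℝ)) * ε i ω) := fun ω => by
    congr 1; ring
  have e2 : ∀ ω, Real.exp (-(ε i ω / s)) = Real.exp (-(1 / (s : ℝ)) * ε i ω) := fun ω => by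
    congr 1; ring
  have hexp : Real.exp (1 / 2) ≤ 2 := by
    have h1 : Real.exp (1 / 2) ^ 2 ≤ 2 ^ 2 := by
      rw [← Real.exp_nat_mul]
      norm_num
      linarith [Real.exp_one_lt_d9]
    exact le_of_sq_le_sq h1 two_pos.le
  have hb : ∀ t : ℝ, t ^ 2 = (1 / (s : ℝ)) ^ 2 → ∫ ω, Real.exp (t * ε i ω) ∂P ≤ 2 := by
    intro t ht
    refine (hsub.mgf_le t).trans (le_trans (le_of_eq ?_) hexp)
    congr 1
    rw [ht]
    push_cast
    field_simp
  simp_rw [e1, e2]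
  have hi1 := hsub.integrable_exp_mul (1 / (s : ℝ))
  have hi2 := hsub.integrable_exp_mul (-(1 / (s : ℝ)))
  refine ⟨hi1.add hi2, ?_⟩
  rw [integral_add hi1 hi2]
  linarith [hb (1 / (s : ℝ)) rfl, hb (-(1 / (s : ℝ))) (by ring)]

/-- The squared errors rescaled by the squared Orlicz norm have exponential moments bounded by an
absolute constant. The factor `4` leaves room because `K` is only a bound for an infimum. -/
theorem exp_moments_sq_div [IsProbabilityMeasure P] (h : IsDesign P X ε s K) (i : Fin N) :
    Integrable (fun ω => Real.exp (ε i ω ^ 2 / (4 * K ^ 2)) +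
      Real.exp (-(ε i ω ^ 2 / (4 * K ^ 2)))) P ∧
      ∫ ω, (Real.exp (ε i ω ^ 2 / (4 * K ^ 2)) +
        Real.exp (-(ε i ω ^ 2 / (4 * K ^ 2)))) ∂P ≤ 4 := by
  have hK := h.K_pos i
  have hm := h.measurable_ε i
  have h1 : psi2Norm (ε i) P < ENNReal.ofReal (2 * K) := by
    refine (h.orlicz_ε i).trans_lt ?_
    rw [← ENNReal.ofReal_coe_nnreal]
    exact (ENNReal.ofReal_lt_ofReal_iff (by linarith)).2 (by linarith)
  obtain ⟨t, ht0, ht1, ht⟩ := exists_lt_of_psi2Norm_lt h1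
  obtain ⟨hi, hle⟩ := integrable_exp_sq_div hm ht
  have hpt : ∀ ω, Real.exp (ε i ω ^ 2 / (4 * K ^ 2)) ≤ Real.exp (ε i ω ^ 2 / t ^ 2) := by
    intro ω
    refine Real.exp_le_exp.2 (div_le_div_of_nonneg_left (sq_nonneg _) (by positivity) ?_)
    nlinarith
  have hi1 : Integrable (fun ω => Real.exp (ε i ω ^ 2 / (4 * K ^ 2))) P :=
    hi.mono' (by fun_prop) (ae_of_all _ fun ω => by
      rw [Real.norm_eq_abs, abs_of_pos (Real.exp_pos _)]
      exact hpt ω)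
  have hle1 : ∀ ω, Real.exp (-(ε i ω ^ 2 / (4 * K ^ 2))) ≤ 1 := fun ω =>
    Real.exp_le_one_iff.2 (neg_nonpos.2 (by positivity))
  have hi2 : Integrable (fun ω => Real.exp (-(ε i ω ^ 2 / (4 * K ^ 2)))) P :=
    integrable_of_abs_le (M := 1) (by fun_prop) fun ω => by
      rw [abs_of_pos (Real.exp_pos _)]
      exact hle1 ω
  refine ⟨hi1.add hi2, ?_⟩
  rw [integral_add hi1 hi2]
  have h2 := (integral_mono hi1 hi hpt).trans hle
  have h3 := integral_mono hi2 (integrable_const 1) hle1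
  simp only [integral_const, probReal_univ, smul_eq_mul, mul_one] at h3
  linarith

theorem integral_mul_ε (h : IsDesign P X ε s K) (i : Fin N) {f : S2 → ℝ} (hf : Measurable f)
    {e : ℝ → ℝ} (he : Measurable e) :
    ∫ ω, f (X i ω) * e (ε i ω) ∂P = (∫ x, f x ∂unifS2) * ∫ ω, e (ε i ω) ∂P := by
  have hind : IndepFun (fun ω => f (X i ω)) (fun ω => e (ε i ω)) P :=
    (h.indep_X_ε i).comp hf he
  rw [hind.integral_fun_mul_eq_mul_integral
    (hf.comp (h.measurable_X i)).aestronglyMeasurable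
    (he.comp (h.measurable_ε i)).aestronglyMeasurable, h.integral_map_X i hf]

end IsDesign

/-! ### The three parts of the error -/

/-- The deviation from `m` of the sample mean of `u(X_i) ψ_{j,k}(X_i) e(ε_i)`. -/
noncomputable def needletError {N : ℕ} (𝒩 : NeedletSystem) (u : S2 → ℝ) (e : ℝ → ℝ)
    (X : Fin N → Ω → S2) (ε : Fin N → Ω → ℝ) (j : ℕ) (k : Fin (𝒩.K j)) (m : ℝ) : Ω → ℝ :=
  sampleError (fun i ω => u (X i ω) * 𝒩.psi j k (X i ω) * e (ε i ω)) m

variable {N : ℕ} {X : Fin N → Ω → S2} {ε : Fin N → Ω → ℝ} {s K : ℝ≥0}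
  {𝒩 : NeedletSystem}

theorem measurable_needletError (h : IsDesign P X ε s K) {u : S2 → ℝ} {e : ℝ → ℝ}
    (hu : Measurable u) (he : Measurable e) (j : ℕ) (k : Fin (𝒩.K j)) (m : ℝ) :
    Measurable (needletError 𝒩 u e X ε j k m) := by
  refine measurable_sampleError (fun i => ?_) m
  have h1 := h.measurable_X i
  have h2 := h.measurable_ε i
  have h3 := (𝒩.continuous_psi j k).measurable
  fun_prop

theorem iIndepFun_needlet (h : IsDesign P X ε s K) {u : S2 → ℝ} {e : ℝ → ℝ}
    (hu : Measurable u) (he : Measurable e) (j : ℕ) (k : Fin (𝒩.K j)) :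
    iIndepFun (fun i ω => u (X i ω) * 𝒩.psi j k (X i ω) * e (ε i ω)) P := by
  have h3 := (𝒩.continuous_psi j k).measurable
  exact h.indep_pairs.comp (fun _ p => u p.1 * 𝒩.psi j k p.1 * e p.2) fun i => by fun_prop

theorem integral_sq_mul_psi_le {C₂ Cinf D : ℝ} (hb : 𝒩.NormBounds C₂ Cinf) {u : S2 → ℝ}
    (hD : ∀ x, |u x| ≤ D) (j : ℕ) (k : Fin (𝒩.K j)) :
    ∫ x, (u x * 𝒩.psi j k x) ^ 2 ∂unifS2 ≤ D ^ 2 * C₂ ^ 2 := by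
  have hψ : Integrable (fun x => D ^ 2 * 𝒩.psi j k x ^ 2) unifS2 :=
    ((𝒩.continuous_psi j k).pow 2).integrable_unifS2.const_mul _
  have hle : ∀ x, (u x * 𝒩.psi j k x) ^ 2 ≤ D ^ 2 * 𝒩.psi j k x ^ 2 := fun x => by
    rw [mul_pow, ← sq_abs (u x)]
    exact mul_le_mul_of_nonneg_right (pow_le_pow_left₀ (abs_nonneg _) (hD x) 2) (sq_nonneg _)
  calc ∫ x, (u x * 𝒩.psi j k x) ^ 2 ∂unifS2 ≤ ∫ x, D ^ 2 * 𝒩.psi j k x ^ 2 ∂unifS2 :=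
        integral_mono_of_nonneg (ae_of_all _ fun x => sq_nonneg _) hψ (ae_of_all _ hle)
    _ = D ^ 2 * ∫ x, 𝒩.psi j k x ^ 2 ∂unifS2 := integral_const_mul _ _
    _ ≤ D ^ 2 * C₂ ^ 2 := mul_le_mul_of_nonneg_left (hb.integral_psi_sq_le j k) (sq_nonneg _)

theorem abs_mul_psi_le {C₂ Cinf D : ℝ} (hb : 𝒩.NormBounds C₂ Cinf) {u : S2 → ℝ}
    (hD : ∀ x, |u x| ≤ D) (j : ℕ) (k : Fin (𝒩.K j)) (x : S2) :
    |u x * 𝒩.psi j k x| ≤ D * (Cinf * 𝒩.B ^ j) := by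
  rw [abs_mul]
  exact mul_le_mul (hD x) (hb.inf_le j k x) (abs_nonneg _) ((abs_nonneg _).trans (hD x))

theorem integral_exp_needletError_le [IsProbabilityMeasure P]
    (h : IsDesign P X ε s K) (hN : 0 < N) {C₂ Cinf D : ℝ}
    (hb : 𝒩.NormBounds C₂ Cinf) {u : S2 → ℝ} {e : ℝ → ℝ} (hu : Measurable u)
    (he : Measurable e) (hD : ∀ x, |u x| ≤ D)
    (he4 : ∀ i, Integrable (fun ω => Real.exp (e (ε i ω)) + Real.exp (-e (ε i ω))) P ∧
      ∫ ω, (Real.exp (e (ε i ω)) + Real.exp (-e (ε i ω))) ∂P ≤ 4)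
    {j : ℕ} {k : Fin (𝒩.K j)} {m : ℝ}
    (hm : ∀ i, ∫ ω, u (X i ω) * 𝒩.psi j k (X i ω) * e (ε i ω) ∂P = m) {t : ℝ}
    (ht : |t| * (D * (Cinf * 𝒩.B ^ j)) ≤ 1 / 2) :
    Integrable (fun ω => Real.exp (t * N * needletError 𝒩 u e X ε j k m ω)) P ∧
    ∫ ω, Real.exp (t * N * needletError 𝒩 u e X ε j k m ω) ∂P ≤
      Real.exp (N * (32 * t ^ 2 * (D ^ 2 * C₂ ^ 2))) := by
  have h3 := (𝒩.continuous_psi j k).measurable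
  refine integral_exp_sampleError_le hN (fun i => ?_) (iIndepFun_needlet h hu he j k) fun i => ?_
  · have h1 := h.measurable_X i
    have h2 := h.measurable_ε i
    fun_prop
  · have hm1 : Measurable fun ω => e (ε i ω) := he.comp (h.measurable_ε i)
    have hind : IndepFun (X i) (fun ω => e (ε i ω)) P := (h.indep_X_ε i).comp measurable_id he
    have hmain := integral_exp_mul_indep_le (h.measurable_X i) hm1 hind (he4 i).1 (he4 i).2
      (a := fun x => t * (u x * 𝒩.psi j k x)) (by fun_prop) (fun x => by
        rw [abs_mul]
        exact (mul_le_mul_of_nonneg_left (abs_mul_psi_le hb hD j k x) (abs_nonneg t)).trans ht)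
    simp only [mul_assoc t] at hmain
    refine ⟨hmain.1, hmain.2.trans (Real.exp_le_exp.2 ?_)⟩
    rw [integral_const_mul, hm i]
    have h4 := h.integral_map_X i (f := fun x => (t * (u x * 𝒩.psi j k x)) ^ 2) (by fun_prop)
    rw [h4]
    simp_rw [mul_pow t]
    rw [integral_const_mul]
    have h5 := mul_le_mul_of_nonneg_left (integral_sq_mul_psi_le hb hD j k) (sq_nonneg t)
    linarith

theorem abs_g_sq_le {g σ : S2 → ℝ} {G S : ℝ} (hgs : IsBoundedPair g σ G S) (x : S2) :
    |g x ^ 2| ≤ G ^ 2 := by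
  rw [abs_pow]
  exact pow_le_pow_left₀ (abs_nonneg _) (hgs.abs_g_le x) 2

theorem abs_mul_g_mul_σ_le {g σ : S2 → ℝ} {G S : ℝ} (hgs : IsBoundedPair g σ G S) (s : ℝ≥0)
    (x : S2) : |2 * s * g x * σ x| ≤ 2 * s * G * S := by
  rw [abs_mul, abs_mul, abs_of_nonneg (hgs.σ_nonneg x),
    abs_of_nonneg (by positivity : 0 ≤ 2 * (s : ℝ))]
  have hG : 0 ≤ G := (abs_nonneg _).trans (hgs.abs_g_le x)
  exact mul_le_mul (mul_le_mul_of_nonneg_left (hgs.abs_g_le x) (by positivity)) (hgs.σ_le x)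
    (hgs.σ_nonneg x) (by positivity)

theorem abs_mul_σ_sq_le {g σ : S2 → ℝ} {G S : ℝ} (hgs : IsBoundedPair g σ G S) (K : ℝ≥0)
    (x : S2) : |4 * (K : ℝ) ^ 2 * σ x ^ 2| ≤ 4 * (K : ℝ) ^ 2 * S ^ 2 := by
  rw [abs_of_nonneg (by positivity)]
  exact mul_le_mul_of_nonneg_left (pow_le_pow_left₀ (hgs.σ_nonneg x) (hgs.σ_le x) 2)
    (by positivity)

/-- Expanding `Y_i² = g² + 2 g σ ε_i + σ² ε_i²` splits the estimation error into a bounded, a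
sub-Gaussian and a sub-exponential part; the last two are written with the rescaled errors `ε / s`
and `ε² / (4 K²)`. -/
theorem hErr_eq [IsProbabilityMeasure P]
    (h : IsDesign P X ε s K) (hN : 0 < N) {g σ : S2 → ℝ} {G S : ℝ}
    (hgs : IsBoundedPair g σ G S) (j : ℕ) (k : Fin (𝒩.K j)) (ω : Ω) :
    hErr 𝒩 g σ X ε j k ω =
      needletError 𝒩 (fun x => g x ^ 2) (fun _ => 1) X ε j k
        (∫ x, g x ^ 2 * 𝒩.psi j k x ∂unifS2) ω +
      needletError 𝒩 (fun x => 2 * s * g x * σ x) (fun y => y / s) X ε j k 0 ω +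
      needletError 𝒩 (fun x => 4 * (K : ℝ) ^ 2 * σ x ^ 2) (fun y => y ^ 2 / (4 * (K : ℝ) ^ 2))
        X ε j k (∫ x, σ x ^ 2 * 𝒩.psi j k x ∂unifS2) ω := by
  have hs := (h.s_pos ⟨0, hN⟩).ne'
  have hK := (h.K_pos ⟨0, hN⟩).ne'
  have hg := hgs.measurable_g
  have hσ := hgs.measurable_σ
  have hψ := (𝒩.continuous_psi j k).measurable
  have hint : ∀ {f : S2 → ℝ} {M : ℝ}, Measurable f → (∀ x, |f x| ≤ M) →
      Integrable (fun x => f x * 𝒩.psi j k x) unifS2 := fun {f M} hf hM =>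
    integrable_of_abs_le (by fun_prop) (abs_mul_psi_le 𝒩.normBounds hM j k)
  have hcoeff : 𝒩.coeff (secondMoment g σ) j k =
      ∫ x, g x ^ 2 * 𝒩.psi j k x ∂unifS2 + ∫ x, σ x ^ 2 * 𝒩.psi j k x ∂unifS2 := by
    rw [← integral_add (hint (hg.pow_const 2) (abs_g_sq_le hgs))
      (hint (M := S ^ 2) (hσ.pow_const 2) fun x => by
        rw [abs_pow]
        exact pow_le_pow_left₀ (abs_nonneg _)
          ((abs_of_nonneg (hgs.σ_nonneg x)).le.trans (hgs.σ_le x)) 2)]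
    unfold NeedletSystem.coeff secondMoment
    congr 1
    ext x
    ring
  have hsum : ∑ i, obsY g σ X ε i ω ^ 2 * 𝒩.psi j k (X i ω) =
      ∑ i, g (X i ω) ^ 2 * 𝒩.psi j k (X i ω) * 1 +
      ∑ i, 2 * s * g (X i ω) * σ (X i ω) * 𝒩.psi j k (X i ω) * (ε i ω / s) +
      ∑ i, 4 * (K : ℝ) ^ 2 * σ (X i ω) ^ 2 * 𝒩.psi j k (X i ω) *
        (ε i ω ^ 2 / (4 * (K : ℝ) ^ 2)) := by
    rw [← Finset.sum_add_distrib, ← Finset.sum_add_distrib]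
    refine Finset.sum_congr rfl fun i _ => ?_
    unfold obsY
    field_simp
    ring
  unfold hErr hHat needletError sampleError
  rw [hsum, hcoeff]
  ring

theorem mean_bounded_part (h : IsDesign P X ε s K) {g : S2 → ℝ} (hg : Measurable g) (j : ℕ)
    (k : Fin (𝒩.K j)) (i : Fin N) :
    ∫ ω, g (X i ω) ^ 2 * 𝒩.psi j k (X i ω) * 1 ∂P = ∫ x, g x ^ 2 * 𝒩.psi j k x ∂unifS2 := by
  have hψ := (𝒩.continuous_psi j k).measurable
  simp only [mul_one]
  exact h.integral_map_X i (f := fun x => g x ^ 2 * 𝒩.psi j k x) (by fun_prop)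

theorem mean_subgaussian_part (h : IsDesign P X ε s K) {g σ : S2 → ℝ} (hg : Measurable g)
    (hσ : Measurable σ) (j : ℕ) (k : Fin (𝒩.K j)) (i : Fin N) :
    ∫ ω, 2 * s * g (X i ω) * σ (X i ω) * 𝒩.psi j k (X i ω) * (ε i ω / s) ∂P = 0 := by
  have hψ := (𝒩.continuous_psi j k).measurable
  rw [h.integral_mul_ε i (f := fun x => 2 * s * g x * σ x * 𝒩.psi j k x)
    (e := fun y => y / s) (by fun_prop) (by fun_prop), integral_div, h.mean_ε i]
  simp

theorem mean_subexponential_part [IsProbabilityMeasure P] (h : IsDesign P X ε s K) {σ : S2 → ℝ}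
    (hσ : Measurable σ) (j : ℕ) (k : Fin (𝒩.K j)) (i : Fin N) :
    ∫ ω, 4 * (K : ℝ) ^ 2 * σ (X i ω) ^ 2 * 𝒩.psi j k (X i ω) *
      (ε i ω ^ 2 / (4 * (K : ℝ) ^ 2)) ∂P = ∫ x, σ x ^ 2 * 𝒩.psi j k x ∂unifS2 := by
  have hψ := (𝒩.continuous_psi j k).measurable
  have hK := (h.K_pos i).ne'
  rw [h.integral_mul_ε i (f := fun x => 4 * (K : ℝ) ^ 2 * σ x ^ 2 * 𝒩.psi j k x)
    (e := fun y => y ^ 2 / (4 * (K : ℝ) ^ 2)) (by fun_prop) (by fun_prop), integral_div,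
    h.var_ε i]
  simp_rw [mul_assoc (4 * (K : ℝ) ^ 2)]
  rw [integral_const_mul]
  field_simp

theorem exp_moments_one [IsProbabilityMeasure P] (ε : Fin N → Ω → ℝ) (i : Fin N) :
    Integrable (fun ω => Real.exp ((fun _ : ℝ => (1 : ℝ)) (ε i ω)) +
      Real.exp (-(fun _ : ℝ => (1 : ℝ)) (ε i ω))) P ∧
    ∫ ω, (Real.exp ((fun _ : ℝ => (1 : ℝ)) (ε i ω)) +
      Real.exp (-(fun _ : ℝ => (1 : ℝ)) (ε i ω))) ∂P ≤ 4 := by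
  refine ⟨integrable_const _, ?_⟩
  simp only [integral_const, probReal_univ, smul_eq_mul, one_mul]
  linarith [Real.exp_one_lt_d9, Real.exp_le_one_iff.2 (show (-1 : ℝ) ≤ 0 by norm_num)]

/-! ### Deviation bounds -/

theorem tauN_pos (hN : 2 ≤ N) : 0 < tauN N := by
  have hN' : (2 : ℝ) ≤ N := by exact_mod_cast hN
  exact Real.sqrt_pos.2 (div_pos (Real.log_pos (by linarith)) (by linarith))

theorem natCast_mul_tauN_sq (hN : 2 ≤ N) : (N : ℝ) * tauN N ^ 2 = Real.log N := by
  have hN' : (2 : ℝ) ≤ N := by exact_mod_cast hN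
  rw [tauN, Real.sq_sqrt (div_nonneg (Real.log_nonneg (by linarith)) (by linarith))]
  field_simp

theorem B_pow_mul_tauN_le (hN : 2 ≤ N) {j : ℕ} (hj : 𝒩.B ^ (2 * j) ≤ N / Real.log N) :
    𝒩.B ^ j * tauN N ≤ 1 := by
  have hN' : (2 : ℝ) ≤ N := by exact_mod_cast hN
  have hlog : 0 < Real.log N := Real.log_pos (by linarith)
  have h1 : (𝒩.B ^ j * tauN N) ^ 2 ≤ 1 ^ 2 := by
    rw [mul_pow, ← pow_mul, mul_comm j 2, tauN,
      Real.sq_sqrt (div_nonneg hlog.le (by linarith)), one_pow]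
    calc 𝒩.B ^ (2 * j) * (Real.log N / N) ≤ N / Real.log N * (Real.log N / N) := by gcongr
      _ = 1 := by field_simp
  exact le_of_sq_le_sq h1 zero_le_one

/-- Deviations of size `κ τ_N / 3` of a part with two exponential moments. -/
theorem measureReal_needletError_le [IsProbabilityMeasure P]
    (h : IsDesign P X ε s K) (hN : 2 ≤ N) {C₂ Cinf D : ℝ}
    (hb : 𝒩.NormBounds C₂ Cinf) {u : S2 → ℝ} {e : ℝ → ℝ} (hu : Measurable u)
    (he : Measurable e) (hD : ∀ x, |u x| ≤ D)
    (he4 : ∀ i, Integrable (fun ω => Real.exp (e (ε i ω)) + Real.exp (-e (ε i ω))) P ∧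
      ∫ ω, (Real.exp (e (ε i ω)) + Real.exp (-e (ε i ω))) ∂P ≤ 4)
    {j : ℕ} (hj : 𝒩.B ^ (2 * j) ≤ N / Real.log N) {k : Fin (𝒩.K j)} {m : ℝ}
    (hm : ∀ i, ∫ ω, u (X i ω) * 𝒩.psi j k (X i ω) * e (ε i ω) ∂P = m) {κ δ : ℝ} (hδ : 0 < δ)
    (hκ : 0 < κ) (h1 : 12 * D * Cinf * δ ≤ κ) (h2 : 1152 * D ^ 2 * C₂ ^ 2 * δ ≤ κ ^ 2) :
    P.real {ω | κ * tauN N / 3 ≤ |needletError 𝒩 u e X ε j k m ω|} ≤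
      2 * Real.exp (-(δ * Real.log N)) := by
  have hN' : (2 : ℝ) ≤ N := by exact_mod_cast hN
  have hNpos : (0 : ℝ) < N := by linarith
  have hτ := tauN_pos hN
  have hlog := natCast_mul_tauN_sq hN
  have hB := B_pow_mul_tauN_le hN hj
  have hD0 : 0 ≤ D := (abs_nonneg _).trans (hD (𝒩.ξ j k))
  have hCi := hb.pos_inf
  set τ := tauN N with hτdef
  -- the Chernoff parameter `2 L / (N t)` for `L = δ log N = δ N τ²` and `t = κ τ / 3`
  set v : ℝ := 6 * δ * τ / κ with hv
  have hv0 : 0 < v := by positivity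
  have hvA : v * (D * (Cinf * 𝒩.B ^ j)) ≤ 1 / 2 := by
    have e1 : v * (D * (Cinf * 𝒩.B ^ j)) = (12 * D * Cinf * δ) * (𝒩.B ^ j * τ) / (2 * κ) := by
      rw [hv]; field_simp; ring
    rw [e1, div_le_iff₀ (by positivity)]
    have hBp : 0 ≤ 𝒩.B ^ j * τ := mul_nonneg (pow_nonneg 𝒩.B_pos.le _) hτ.le
    have : (12 * D * Cinf * δ) * (𝒩.B ^ j * τ) ≤ κ * 1 :=
      mul_le_mul h1 hB hBp hκ.le
    linarith
  have hq : N * (32 * v ^ 2 * (D ^ 2 * C₂ ^ 2)) ≤ δ * Real.log N := by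
    have e1 : N * (32 * v ^ 2 * (D ^ 2 * C₂ ^ 2)) =
        (1152 * D ^ 2 * C₂ ^ 2 * δ) / κ ^ 2 * (δ * (N * τ ^ 2)) := by
      rw [hv]; field_simp; ring
    rw [e1, hlog]
    have h3 : (1152 * D ^ 2 * C₂ ^ 2 * δ) / κ ^ 2 ≤ 1 := (div_le_one (by positivity)).2 h2
    have h4 : 0 ≤ δ * Real.log N := by rw [← hlog]; positivity
    nlinarith
  have hp := integral_exp_needletError_le h (by omega) hb hu he hD he4 hm
    (t := v) (by rwa [abs_of_pos hv0])
  have hn := integral_exp_needletError_le h (by omega) hb hu he hD he4 hm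
    (t := -v) (by rwa [abs_neg, abs_of_pos hv0])
  rw [neg_sq] at hn
  simp only [neg_mul v (N : ℝ)] at hn
  refine measureReal_abs_ge_le_two_mul_exp (u := v * N) (by positivity)
    ⟨hp.1, hp.2.trans (Real.exp_le_exp.2 hq)⟩ ⟨hn.1, hn.2.trans (Real.exp_le_exp.2 hq)⟩
    (le_of_eq ?_)
  rw [← hlog, hv]
  field_simp
  ring

/-- Deviations of size `κ τ_N / 3` of the bounded part, from Bernstein's inequality. -/
theorem measureReal_bounded_part_le [IsProbabilityMeasure P]
    (h : IsDesign P X ε s K) (hN : 2 ≤ N) {C₂ Cinf D : ℝ}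
    (hb : 𝒩.NormBounds C₂ Cinf) {u : S2 → ℝ} (hu : Measurable u) (hD : ∀ x, |u x| ≤ D)
    {j : ℕ} (hj : 𝒩.B ^ (2 * j) ≤ N / Real.log N) {k : Fin (𝒩.K j)} {m : ℝ}
    (hm : ∀ i, ∫ ω, u (X i ω) * 𝒩.psi j k (X i ω) * 1 ∂P = m) {κ δ : ℝ} (hδ : 0 < δ)
    (hκ : 0 < κ) (h1 : 18 * D ^ 2 * C₂ ^ 2 * δ + 6 * D * Cinf * δ * κ < κ ^ 2) :
    P.real {ω | κ * tauN N / 3 ≤ |needletError 𝒩 u (fun _ => 1) X ε j k m ω|} ≤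
      2 * Real.exp (-(δ * Real.log N)) := by
  have hN' : (2 : ℝ) ≤ N := by exact_mod_cast hN
  have hNpos : (0 : ℝ) < N := by linarith
  have hτ := tauN_pos hN
  have hlog := natCast_mul_tauN_sq hN
  have hB := B_pow_mul_tauN_le hN hj
  have hD0 : 0 ≤ D := (abs_nonneg _).trans (hD (𝒩.ξ j k))
  have hCi := hb.pos_inf
  have hψ := (𝒩.continuous_psi j k).measurable
  set τ := tauN N with hτdef
  -- the same Chernoff parameter as for the unbounded parts
  set v : ℝ := 6 * δ * τ / κ with hv
  have hv0 : 0 < v := by positivity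
  -- the bound of a summand; `v A ≤ 6 D Cinf δ / κ` and the variance term sum to less than `1`
  set A : ℝ := D * (Cinf * 𝒩.B ^ j) with hA
  have hA0 : 0 ≤ A := mul_nonneg hD0 (mul_nonneg hCi.le (pow_nonneg 𝒩.B_pos.le _))
  have hvA : v * A ≤ 6 * D * Cinf * δ / κ := by
    have e1 : v * A = 6 * D * Cinf * δ / κ * (𝒩.B ^ j * τ) := by
      rw [hv, hA]; field_simp
    rw [e1]
    exact mul_le_of_le_one_right (by positivity) hB
  have hfrac : 18 * D ^ 2 * C₂ ^ 2 * δ / κ ^ 2 + 6 * D * Cinf * δ / κ < 1 := by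
    have e1 : 18 * D ^ 2 * C₂ ^ 2 * δ / κ ^ 2 + 6 * D * Cinf * δ / κ =
        (18 * D ^ 2 * C₂ ^ 2 * δ + 6 * D * Cinf * δ * κ) / κ ^ 2 := by field_simp
    rw [e1]
    exact (div_lt_one (by positivity)).2 h1
  have hnn : 0 ≤ 18 * D ^ 2 * C₂ ^ 2 * δ / κ ^ 2 := by positivity
  have hvA1 : v * A < 1 := by linarith
  have hq : N * (v ^ 2 * (D ^ 2 * C₂ ^ 2) / (2 * (1 - v * A))) ≤ δ * Real.log N := by
    have e1 : N * (v ^ 2 * (D ^ 2 * C₂ ^ 2) / (2 * (1 - v * A))) =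
        (18 * D ^ 2 * C₂ ^ 2 * δ / κ ^ 2) / (1 - v * A) * (δ * (N * τ ^ 2)) := by
      have : 1 - v * A ≠ 0 := by linarith
      rw [show v ^ 2 = (6 * δ * τ / κ) ^ 2 by rw [hv]]
      field_simp
      ring
    rw [e1, hlog]
    have h3 : (18 * D ^ 2 * C₂ ^ 2 * δ / κ ^ 2) / (1 - v * A) ≤ 1 :=
      (div_le_one (by linarith)).2 (by linarith)
    have h4 : 0 ≤ δ * Real.log N := by rw [← hlog]; positivity
    nlinarith
  have hmain : ∀ t : ℝ, |t| = v →
      Integrable (fun ω => Real.exp (t * N * needletError 𝒩 u (fun _ => 1) X ε j k m ω)) P ∧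
      ∫ ω, Real.exp (t * N * needletError 𝒩 u (fun _ => 1) X ε j k m ω) ∂P ≤
        Real.exp (δ * Real.log N) := by
    intro t ht
    have hmeas : ∀ i, Measurable fun ω => u (X i ω) * 𝒩.psi j k (X i ω) * 1 := fun i => by
      have := h.measurable_X i
      fun_prop
    have hE := integral_exp_sampleError_le (by omega) hmeas
      (iIndepFun_needlet h hu (e := fun _ => 1) (by fun_prop) j k) (t := t) (m := m)
      (q := t ^ 2 * (D ^ 2 * C₂ ^ 2) / (2 * (1 - |t| * A))) (fun i => by
        have hV : ∫ ω, (u (X i ω) * 𝒩.psi j k (X i ω) * 1) ^ 2 ∂P ≤ D ^ 2 * C₂ ^ 2 := by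
          simp only [mul_one]
          rw [h.integral_map_X i (f := fun x => (u x * 𝒩.psi j k x) ^ 2) (by fun_prop)]
          exact integral_sq_mul_psi_le hb hD j k
        have h5 := integral_exp_mul_bounded_le (hmeas i) (M := A) (t := t) (fun ω => by
          rw [mul_one]
          exact abs_mul_psi_le hb hD j k _) hV (by rwa [ht])
        rwa [hm i] at h5)
    refine ⟨hE.1, hE.2.trans (Real.exp_le_exp.2 ?_)⟩
    rw [← sq_abs t, ht]
    exact hq
  have hn := hmain (-v) (by rw [abs_neg, abs_of_pos hv0])
  simp only [neg_mul v (N : ℝ)] at hn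
  refine measureReal_abs_ge_le_two_mul_exp (u := v * N) (by positivity)
    (hmain v (abs_of_pos hv0)) hn (le_of_eq ?_)
  rw [← hlog, hv]
  field_simp
  ring

end Model

section Deviation

variable {Ω : Type*} [MeasurableSpace Ω] {P : Measure Ω}
  {N : ℕ} {X : Fin N → Ω → S2} {ε : Fin N → Ω → ℝ} {s K : ℝ≥0} {𝒩 : NeedletSystem}

theorem kappaStar_lt_iff {C₂ Cinf G S s K cS cη δ κ : ℝ} :
    kappaStar C₂ Cinf G S s K cS cη δ < κ ↔
      3 * G ^ 2 * δ * Cinf +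
        Real.sqrt (9 * G ^ 4 * δ ^ 2 * Cinf ^ 2 + 18 * G ^ 4 * δ * C₂ ^ 2) < κ ∧
      (4 * Cinf * G * S * s / Real.sqrt (6 * cS) * δ < κ ∧
        2 * C₂ * G * S * s * Real.sqrt (δ / cS) < κ) ∧
      6 * K ^ 2 * S ^ 2 * Cinf / cη * δ < κ ∧
        6 * K ^ 2 * S ^ 2 * C₂ * Real.sqrt (δ / cη) < κ := by
  simp only [kappaStar, max_lt_iff]

theorem measureReal_hErr_le [IsProbabilityMeasure P]
    (h : IsDesign P X ε s K) (hN : 2 ≤ N) {C₂ Cinf : ℝ}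
    (hb : 𝒩.NormBounds C₂ Cinf) {g σ : S2 → ℝ} {G S : ℝ} (hgs : IsBoundedPair g σ G S)
    {j : ℕ} (hj : 𝒩.B ^ (2 * j) ≤ N / Real.log N) (k : Fin (𝒩.K j)) {κ δ : ℝ} (hδ : 0 < δ)
    (hκ : kappaStar C₂ Cinf G S s K (1 / 1536) (1 / 512) δ < κ) :
    P.real {ω | κ * tauN N ≤ |hErr 𝒩 g σ X ε j k ω|} ≤ 6 * (N : ℝ) ^ (-δ) := by
  have hN' : (2 : ℝ) ≤ N := by exact_mod_cast hN
  have hG : 0 ≤ G := (abs_nonneg _).trans (hgs.abs_g_le (𝒩.ξ j k))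
  have hS : 0 ≤ S := (hgs.σ_nonneg (𝒩.ξ j k)).trans (hgs.σ_le _)
  have hC2 := hb.pos_two
  have hCi := hb.pos_inf
  have hs0 : (0 : ℝ) ≤ s := s.2
  have hg := hgs.measurable_g
  have hσ := hgs.measurable_σ
  obtain ⟨k1, ⟨k2, k3⟩, k4, k5⟩ := kappaStar_lt_iff.1 hκ
  have hκ0 : 0 < κ := lt_of_le_of_lt (by positivity) k1
  have p1 := measureReal_bounded_part_le h hN hb (u := fun x => g x ^ 2) (D := G ^ 2)
    (by fun_prop) (abs_g_sq_le hgs) hj (mean_bounded_part h hg j k) hδ hκ0 (by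
      -- `κ` exceeds the larger root of the quadratic polynomial of the Bernstein condition
      have h1 := Real.lt_sq_of_sqrt_lt (lt_sub_iff_add_lt'.2 k1)
      nlinarith)
  have p2 := measureReal_needletError_le h hN hb (u := fun x => 2 * s * g x * σ x)
    (D := 2 * s * G * S) (e := fun y => y / s) (by fun_prop) (by fun_prop)
    (abs_mul_g_mul_σ_le hgs s) h.exp_moments_div hj (mean_subgaussian_part h hg hσ j k) hδ hκ0 (by
      have e1 : Real.sqrt (6 * (1 / 1536)) = 1 / 16 := by
        rw [show (6 : ℝ) * (1 / 1536) = (1 / 16) ^ 2 by norm_num]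
        exact Real.sqrt_sq (by norm_num)
      rw [e1] at k2
      have : 0 ≤ Cinf * G * S * s * δ := by positivity
      linarith) (by
      have h1 := pow_le_pow_left₀ (by positivity) k3.le 2
      rw [mul_pow, Real.sq_sqrt (by positivity)] at h1
      have : 0 ≤ C₂ ^ 2 * G ^ 2 * S ^ 2 * s ^ 2 * δ := by positivity
      linarith)
  have p3 := measureReal_needletError_le h hN hb (u := fun x => 4 * (K : ℝ) ^ 2 * σ x ^ 2)
    (D := 4 * (K : ℝ) ^ 2 * S ^ 2) (e := fun y => y ^ 2 / (4 * (K : ℝ) ^ 2)) (by fun_prop)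
    (by fun_prop) (abs_mul_σ_sq_le hgs K) h.exp_moments_sq_div hj
    (mean_subexponential_part h hσ j k) hδ hκ0 (by
      have : 0 ≤ (K : ℝ) ^ 2 * S ^ 2 * Cinf * δ := by positivity
      linarith) (by
      have h1 := pow_le_pow_left₀ (by positivity) k5.le 2
      rw [mul_pow, Real.sq_sqrt (by positivity)] at h1
      linarith)
  have hexp : Real.exp (-(δ * Real.log N)) = (N : ℝ) ^ (-δ) := by
    rw [Real.rpow_def_of_pos (by linarith)]
    congr 1
    ring
  rw [hexp] at p1 p2 p3
  set E1 := needletError 𝒩 (fun x => g x ^ 2) (fun _ => 1) X ε j k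
    (∫ x, g x ^ 2 * 𝒩.psi j k x ∂unifS2)
  set E2 := needletError 𝒩 (fun x => 2 * s * g x * σ x) (fun y => y / s) X ε j k 0
  set E3 := needletError 𝒩 (fun x => 4 * (K : ℝ) ^ 2 * σ x ^ 2)
    (fun y => y ^ 2 / (4 * (K : ℝ) ^ 2)) X ε j k (∫ x, σ x ^ 2 * 𝒩.psi j k x ∂unifS2)
  have hsub : {ω | κ * tauN N ≤ |hErr 𝒩 g σ X ε j k ω|} ⊆
      {ω | κ * tauN N / 3 ≤ |E1 ω|} ∪
        ({ω | κ * tauN N / 3 ≤ |E2 ω|} ∪ {ω | κ * tauN N / 3 ≤ |E3 ω|}) := by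
    intro ω hω
    simp only [Set.mem_ofPred_eq, Set.mem_union] at hω ⊢
    rw [hErr_eq h (by omega) hgs] at hω
    have h1 := abs_add_three (E1 ω) (E2 ω) (E3 ω)
    by_contra! hcon
    linarith [hcon.1, hcon.2.1, hcon.2.2]
  calc _ ≤ _ := measureReal_mono hsub
    _ ≤ _ := (measureReal_union_le _ _).trans
        (add_le_add_right (measureReal_union_le _ _) _)
    _ ≤ 6 * (N : ℝ) ^ (-δ) := by linarith

end Deviation

/-! ### Moment bounds -/

/-- Powers are dominated by exponentials, with an arbitrary shift `L` which costs `L ^ r`. -/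
theorem exists_rpow_le_rpow_add_exp {r : ℝ} (hr : 0 < r) : ∃ C : ℝ, 0 < C ∧
    ∀ y L : ℝ, 0 ≤ y → 0 ≤ L → y ^ r ≤ 2 ^ r * L ^ r + C * Real.exp (y - L) := by
  refine ⟨(2 * r) ^ r, by positivity, fun y L hy hL => ?_⟩
  rcases le_total y (2 * L) with h | h
  · rw [← Real.mul_rpow two_pos.le hL]
    have h1 := Real.rpow_le_rpow hy h hr.le
    have h2 : 0 ≤ (2 * r) ^ r * Real.exp (y - L) := by positivity
    linarith
  · have h1 : y ≤ 2 * r * Real.exp (y / (2 * r)) := by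
      have h2 := Real.add_one_le_exp (y / (2 * r))
      calc y = 2 * r * (y / (2 * r)) := by field_simp
        _ ≤ _ := by
          apply mul_le_mul_of_nonneg_left _ (by positivity)
          linarith
    have h3 := Real.rpow_le_rpow hy h1 hr.le
    rw [Real.mul_rpow (by positivity) (Real.exp_pos _).le, ← Real.exp_mul] at h3
    have h4 : Real.exp (y / (2 * r) * r) ≤ Real.exp (y - L) := by
      apply Real.exp_le_exp.2
      have : y / (2 * r) * r = y / 2 := by field_simp
      rw [this]
      linarith
    have h5 : 0 ≤ (2 : ℝ) ^ r * L ^ r := by positivity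
    have h6 := mul_le_mul_of_nonneg_left h4 (by positivity : 0 ≤ (2 * r) ^ r)
    linarith

section Moments

variable {Ω : Type*} [MeasurableSpace Ω] {P : Measure Ω}
  {N : ℕ} {X : Fin N → Ω → S2} {ε : Fin N → Ω → ℝ} {s K : ℝ≥0} {𝒩 : NeedletSystem}

theorem measurable_hErr (h : IsDesign P X ε s K) {g σ : S2 → ℝ} {G S : ℝ}
    (hgs : IsBoundedPair g σ G S) (j : ℕ) (k : Fin (𝒩.K j)) :
    Measurable (hErr 𝒩 g σ X ε j k) := by
  have hg := hgs.measurable_g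
  have hσ := hgs.measurable_σ
  have hψ := (𝒩.continuous_psi j k).measurable
  have hX := h.measurable_X
  have hε := h.measurable_ε
  unfold hErr hHat obsY
  fun_prop

/-- Exponential moment, at the scale `√N`, of the absolute value of one part of the error. -/
theorem integral_exp_abs_needletError_le [IsProbabilityMeasure P]
    (h : IsDesign P X ε s K) (hN : 0 < N) {C₂ Cinf D : ℝ}
    (hb : 𝒩.NormBounds C₂ Cinf) {u : S2 → ℝ} {e : ℝ → ℝ} (hu : Measurable u)
    (he : Measurable e) (hD : ∀ x, |u x| ≤ D)
    (he4 : ∀ i, Integrable (fun ω => Real.exp (e (ε i ω)) + Real.exp (-e (ε i ω))) P ∧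
      ∫ ω, (Real.exp (e (ε i ω)) + Real.exp (-e (ε i ω))) ∂P ≤ 4)
    {j : ℕ} {k : Fin (𝒩.K j)} {m : ℝ}
    (hm : ∀ i, ∫ ω, u (X i ω) * 𝒩.psi j k (X i ω) * e (ε i ω) ∂P = m) {θ : ℝ} (hθ : 0 ≤ θ)
    (hj : 𝒩.B ^ j ≤ 2 * Real.sqrt N) (hθD : θ * (D * Cinf) ≤ 1 / 4) :
    Integrable (fun ω => Real.exp (θ * Real.sqrt N * |needletError 𝒩 u e X ε j k m ω|)) P ∧
    ∫ ω, Real.exp (θ * Real.sqrt N * |needletError 𝒩 u e X ε j k m ω|) ∂P ≤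
      2 * Real.exp (32 * θ ^ 2 * (D ^ 2 * C₂ ^ 2)) := by
  have hN' : (0 : ℝ) < N := by exact_mod_cast hN
  have hD0 : 0 ≤ D := (abs_nonneg _).trans (hD (𝒩.ξ j k))
  have hCi := hb.pos_inf
  have hsq : 0 < Real.sqrt N := Real.sqrt_pos.2 hN'
  have hsq2 : Real.sqrt N * Real.sqrt N = N := Real.mul_self_sqrt hN'.le
  have hmain : ∀ t : ℝ, |t| = θ / Real.sqrt N →
      Integrable (fun ω => Real.exp (t * N * needletError 𝒩 u e X ε j k m ω)) P ∧
      ∫ ω, Real.exp (t * N * needletError 𝒩 u e X ε j k m ω) ∂P ≤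
        Real.exp (32 * θ ^ 2 * (D ^ 2 * C₂ ^ 2)) := by
    intro t ht
    have h1 := integral_exp_needletError_le h hN hb hu he hD he4 hm (t := t) (by
      rw [ht]
      have e1 : θ / Real.sqrt N * (D * (Cinf * 𝒩.B ^ j)) =
          θ * (D * Cinf) * (𝒩.B ^ j / Real.sqrt N) := by field_simp
      have e2 : 𝒩.B ^ j / Real.sqrt N ≤ 2 := (div_le_iff₀ hsq).2 hj
      rw [e1]
      have e3 : 0 ≤ θ * (D * Cinf) := by positivity
      nlinarith)
    have e4 : N * (32 * t ^ 2 * (D ^ 2 * C₂ ^ 2)) = 32 * θ ^ 2 * (D ^ 2 * C₂ ^ 2) := by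
      rw [← sq_abs t, ht, div_pow, Real.sq_sqrt hN'.le]
      field_simp
    rwa [e4] at h1
  have hθN : 0 ≤ θ / Real.sqrt N := by positivity
  have hp := hmain (θ / Real.sqrt N) (abs_of_nonneg hθN)
  have hn := hmain (-(θ / Real.sqrt N)) (by rw [abs_neg, abs_of_nonneg hθN])
  have e5 : θ / Real.sqrt N * N = θ * Real.sqrt N := by
    rw [div_mul_eq_mul_div, div_eq_iff hsq.ne', mul_assoc, hsq2]
  rw [e5] at hp
  rw [neg_mul, e5] at hn
  have hmeas := measurable_needletError h hu he j k m
  have hle : ∀ ω, Real.exp (θ * Real.sqrt N * |needletError 𝒩 u e X ε j k m ω|) ≤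
      Real.exp (θ * Real.sqrt N * needletError 𝒩 u e X ε j k m ω) +
        Real.exp (-(θ * Real.sqrt N) * needletError 𝒩 u e X ε j k m ω) := by
    intro ω
    rcases abs_cases (needletError 𝒩 u e X ε j k m ω) with ⟨h1, _⟩ | ⟨h1, _⟩
    · rw [h1]
      linarith [Real.exp_pos (-(θ * Real.sqrt N) * needletError 𝒩 u e X ε j k m ω)]
    · rw [h1, mul_neg, neg_mul]
      linarith [Real.exp_pos (θ * Real.sqrt N * needletError 𝒩 u e X ε j k m ω)]
  have hi : Integrable (fun ω =>
      Real.exp (θ * Real.sqrt N * |needletError 𝒩 u e X ε j k m ω|)) P := by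
    refine (hp.1.add hn.1).mono' ?_ (ae_of_all _ fun ω => ?_)
    · have h2 : Measurable fun ω => |needletError 𝒩 u e X ε j k m ω| := hmeas.abs
      exact (Real.measurable_exp.comp (h2.const_mul _)).aestronglyMeasurable
    · rw [Real.norm_eq_abs, abs_of_pos (Real.exp_pos _)]
      exact hle ω
  refine ⟨hi, ?_⟩
  have h3 := integral_mono hi (hp.1.add hn.1) hle
  simp only [Pi.add_apply] at h3
  rw [integral_add hp.1 hn.1] at h3
  linarith [hp.2, hn.2]

/-- The constant `D` bounds the three functions multiplying the rescaled errors. -/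
theorem integral_exp_abs_hErr_le [IsProbabilityMeasure P]
    (h : IsDesign P X ε s K) (hN : 0 < N) {C₂ Cinf D : ℝ}
    (hb : 𝒩.NormBounds C₂ Cinf) {g σ : S2 → ℝ} {G S : ℝ} (hgs : IsBoundedPair g σ G S)
    (hD1 : G ^ 2 ≤ D) (hD2 : 2 * s * G * S ≤ D) (hD3 : 4 * (K : ℝ) ^ 2 * S ^ 2 ≤ D)
    {j : ℕ} (k : Fin (𝒩.K j)) {c : ℝ} (hc : 0 ≤ c)
    (hj : 𝒩.B ^ j ≤ 2 * Real.sqrt N) (hcD : 3 * c * (D * Cinf) ≤ 1 / 4) :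
    Integrable (fun ω => Real.exp (c * Real.sqrt N * |hErr 𝒩 g σ X ε j k ω|)) P ∧
    ∫ ω, Real.exp (c * Real.sqrt N * |hErr 𝒩 g σ X ε j k ω|) ∂P ≤
      6 * Real.exp (32 * (3 * c) ^ 2 * (D ^ 2 * C₂ ^ 2)) := by
  have hg := hgs.measurable_g
  have hσ := hgs.measurable_σ
  have p1 := integral_exp_abs_needletError_le h hN hb (u := fun x => g x ^ 2) (D := D)
    (e := fun _ => 1) (by fun_prop) (by fun_prop) (fun x => (abs_g_sq_le hgs x).trans hD1)
    (exp_moments_one ε) (mean_bounded_part h hg j k) (θ := 3 * c) (by positivity) hj hcD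
  have p2 := integral_exp_abs_needletError_le h hN hb (u := fun x => 2 * s * g x * σ x)
    (D := D) (e := fun y => y / s) (by fun_prop) (by fun_prop)
    (fun x => (abs_mul_g_mul_σ_le hgs s x).trans hD2) h.exp_moments_div
    (mean_subgaussian_part h hg hσ j k) (θ := 3 * c) (by positivity) hj hcD
  have p3 := integral_exp_abs_needletError_le h hN hb (u := fun x => 4 * (K : ℝ) ^ 2 * σ x ^ 2)
    (D := D) (e := fun y => y ^ 2 / (4 * (K : ℝ) ^ 2)) (by fun_prop)
    (by fun_prop) (fun x => (abs_mul_σ_sq_le hgs K x).trans hD3) h.exp_moments_sq_div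
    (mean_subexponential_part h hσ j k) (θ := 3 * c) (by positivity) hj hcD
  set E1 := needletError 𝒩 (fun x => g x ^ 2) (fun _ => 1) X ε j k
    (∫ x, g x ^ 2 * 𝒩.psi j k x ∂unifS2)
  set E2 := needletError 𝒩 (fun x => 2 * s * g x * σ x) (fun y => y / s) X ε j k 0
  set E3 := needletError 𝒩 (fun x => 4 * (K : ℝ) ^ 2 * σ x ^ 2)
    (fun y => y ^ 2 / (4 * (K : ℝ) ^ 2)) X ε j k (∫ x, σ x ^ 2 * 𝒩.psi j k x ∂unifS2)
  have hq : 0 ≤ c * Real.sqrt N := by positivity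
  have hle : ∀ ω, Real.exp (c * Real.sqrt N * |hErr 𝒩 g σ X ε j k ω|) ≤
      Real.exp (3 * c * Real.sqrt N * |E1 ω|) + Real.exp (3 * c * Real.sqrt N * |E2 ω|) +
        Real.exp (3 * c * Real.sqrt N * |E3 ω|) := by
    intro ω
    have h1 : |hErr 𝒩 g σ X ε j k ω| ≤ |E1 ω| + |E2 ω| + |E3 ω| := by
      rw [hErr_eq h hN hgs]
      exact abs_add_three _ _ _
    have hpos1 := Real.exp_pos (3 * c * Real.sqrt N * |E1 ω|)
    have hpos2 := Real.exp_pos (3 * c * Real.sqrt N * |E2 ω|)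
    have hpos3 := Real.exp_pos (3 * c * Real.sqrt N * |E3 ω|)
    -- the sum is at most three times its largest term
    have hmax : ∀ y, |hErr 𝒩 g σ X ε j k ω| ≤ 3 * y →
        Real.exp (c * Real.sqrt N * |hErr 𝒩 g σ X ε j k ω|) ≤
          Real.exp (3 * c * Real.sqrt N * y) := fun y hy => by
      apply Real.exp_le_exp.2
      have := mul_le_mul_of_nonneg_left hy hq
      linarith
    rcases le_total |E1 ω| |E2 ω| with h12 | h12
    · rcases le_total |E2 ω| |E3 ω| with h23 | h23
      · linarith [hmax |E3 ω| (by linarith)]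
      · linarith [hmax |E2 ω| (by linarith)]
    · rcases le_total |E1 ω| |E3 ω| with h13 | h13
      · linarith [hmax |E3 ω| (by linarith)]
      · linarith [hmax |E1 ω| (by linarith)]
  have hint12 : Integrable (fun ω => Real.exp (3 * c * Real.sqrt N * |E1 ω|) +
      Real.exp (3 * c * Real.sqrt N * |E2 ω|)) P := p1.1.add p2.1
  have hint : Integrable (fun ω => Real.exp (3 * c * Real.sqrt N * |E1 ω|) +
      Real.exp (3 * c * Real.sqrt N * |E2 ω|) + Real.exp (3 * c * Real.sqrt N * |E3 ω|)) P :=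
    hint12.add p3.1
  have hi : Integrable (fun ω => Real.exp (c * Real.sqrt N * |hErr 𝒩 g σ X ε j k ω|)) P := by
    refine hint.mono' ?_ (ae_of_all _ fun ω => ?_)
    · have h2 : Measurable fun ω => |hErr 𝒩 g σ X ε j k ω| := (measurable_hErr h hgs j k).abs
      exact (Real.measurable_exp.comp (h2.const_mul _)).aestronglyMeasurable
    · rw [Real.norm_eq_abs, abs_of_pos (Real.exp_pos _)]
      exact hle ω
  refine ⟨hi, ?_⟩
  have h3 := integral_mono hi hint hle
  rw [integral_add hint12 p3.1, integral_add p1.1 p2.1] at h3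
  linarith [p1.2, p2.2, p3.2]

end Moments

/-- Moments of a finite family of variables with a common exponential moment `A`: the maximum over
at most `e ^ L` variables costs a factor of order `L ^ r`. -/
theorem integral_iSup_rpow_le {Ω : Type*} [MeasurableSpace Ω] {P : Measure Ω}
    [IsProbabilityMeasure P] {r C : ℝ} (hC : 0 < C)
    (hrC : ∀ y L : ℝ, 0 ≤ y → 0 ≤ L → y ^ r ≤ 2 ^ r * L ^ r + C * Real.exp (y - L))
    {n : ℕ} {Y : Fin n → Ω → ℝ} (hY : ∀ k, Measurable (Y k)) {a A L : ℝ} (ha : 0 < a)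
    (hL : 0 ≤ L) (hn : (n : ℝ) ≤ Real.exp L)
    (hE : ∀ k, Integrable (fun ω => Real.exp (a * |Y k ω|)) P ∧
      ∫ ω, Real.exp (a * |Y k ω|) ∂P ≤ A) (hA : 0 ≤ A) :
    Integrable (fun ω => ⨆ k, |Y k ω| ^ r) P ∧
      ∫ ω, (⨆ k, |Y k ω| ^ r) ∂P ≤ a ^ (-r) * (2 ^ r * L ^ r + C * A) := by
  have hmeas : Measurable fun ω => ⨆ k, |Y k ω| ^ r :=
    Measurable.iSup fun k => ((hY k).abs).pow_const r
  have hnn : ∀ ω, 0 ≤ ⨆ k, |Y k ω| ^ r := fun ω => Real.iSup_nonneg fun k => by positivity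
  have har : 0 < a ^ (-r) := Real.rpow_pos_of_pos ha _
  have hscale : ∀ y : ℝ, 0 ≤ y → y ^ r = a ^ (-r) * (a * y) ^ r := fun y hy => by
    rw [Real.mul_rpow ha.le hy, ← mul_assoc, ← Real.rpow_add ha, neg_add_cancel, Real.rpow_zero,
      one_mul]
  have hsum : Integrable (fun ω => ∑ k, Real.exp (a * |Y k ω|)) P :=
    integrable_finsetSum _ fun k _ => (hE k).1
  set F : Ω → ℝ := fun ω => a ^ (-r) * (2 ^ r * L ^ r + C * Real.exp (-L) *
    ∑ k, Real.exp (a * |Y k ω|)) with hF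
  have hFi : Integrable F P :=
    ((integrable_const _).add (hsum.const_mul (C * Real.exp (-L)))).const_mul _
  have hle : ∀ ω, ⨆ k, |Y k ω| ^ r ≤ F ω := by
    intro ω
    have hs0 : 0 ≤ ∑ k, Real.exp (a * |Y k ω|) := Finset.sum_nonneg fun k _ => (Real.exp_pos _).le
    refine Real.iSup_le (fun k => ?_) (by positivity)
    rw [hscale _ (abs_nonneg _)]
    refine mul_le_mul_of_nonneg_left ?_ har.le
    refine (hrC (a * |Y k ω|) L (by positivity) hL).trans ?_
    have h1 : Real.exp (a * |Y k ω|) ≤ ∑ k, Real.exp (a * |Y k ω|) :=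
      Finset.single_le_sum (f := fun k => Real.exp (a * |Y k ω|))
        (fun k _ => (Real.exp_pos _).le) (Finset.mem_univ k)
    have h2 : C * Real.exp (a * |Y k ω| - L) ≤
        C * Real.exp (-L) * ∑ k, Real.exp (a * |Y k ω|) := by
      rw [sub_eq_add_neg, Real.exp_add, mul_assoc, mul_comm (Real.exp (-L))]
      gcongr
    linarith
  have hi : Integrable (fun ω => ⨆ k, |Y k ω| ^ r) P :=
    hFi.mono' hmeas.aestronglyMeasurable (ae_of_all _ fun ω => by
      rw [Real.norm_eq_abs, abs_of_nonneg (hnn ω)]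
      exact hle ω)
  refine ⟨hi, (integral_mono hi hFi hle).trans ?_⟩
  simp only [hF]
  rw [integral_const_mul, integral_add (integrable_const _) (hsum.const_mul _),
    integral_const_mul (C * Real.exp (-L)), integral_finsetSum _ fun k _ => (hE k).1]
  simp only [integral_const, probReal_univ, smul_eq_mul, one_mul]
  refine mul_le_mul_of_nonneg_left ?_ har.le
  have h3 : ∑ k, ∫ ω, Real.exp (a * |Y k ω|) ∂P ≤ n * A := by
    refine (Finset.sum_le_sum fun k _ => (hE k).2).trans (le_of_eq ?_)
    simp
  have h4 : C * Real.exp (-L) * ∑ k, ∫ ω, Real.exp (a * |Y k ω|) ∂P ≤ C * A := by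
    calc C * Real.exp (-L) * ∑ k, ∫ ω, Real.exp (a * |Y k ω|) ∂P
        ≤ C * Real.exp (-L) * (Real.exp L * A) := by
          refine mul_le_mul_of_nonneg_left (h3.trans ?_) (by positivity)
          exact mul_le_mul_of_nonneg_right hn hA
      _ = C * A * (Real.exp (-L) * Real.exp L) := by ring
      _ = C * A := by rw [← Real.exp_add, neg_add_cancel, Real.exp_zero, mul_one]
  linarith

theorem NeedletSystem.exists_card_le_exp (𝒩 : NeedletSystem) : ∃ c : ℝ, 0 < c ∧
    ∀ j : ℕ, (𝒩.K j : ℝ) ≤ Real.exp (c * ((j : ℝ) + 1)) := by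
  obtain ⟨_, C, _, hC, h⟩ := 𝒩.card_equiv
  have hB := 𝒩.B_pos
  have hlB : 0 < Real.log 𝒩.B := Real.log_pos 𝒩.one_lt_B
  have hlC : 0 < Real.log (C + 1) := Real.log_pos (by linarith)
  refine ⟨Real.log (C + 1) + 2 * Real.log 𝒩.B, by positivity, fun j => (h j).2.trans ?_⟩
  calc C * 𝒩.B ^ (2 * j) ≤ (C + 1) * 𝒩.B ^ (2 * j) := by gcongr; linarith
    _ = Real.exp (Real.log (C + 1) + (2 * j : ℕ) * Real.log 𝒩.B) := by
      rw [Real.exp_add, Real.exp_log (by linarith), Real.exp_nat_mul, Real.exp_log hB]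
    _ ≤ _ := by
      apply Real.exp_le_exp.2
      push_cast
      have : 0 ≤ Real.log (C + 1) * j := by positivity
      linarith

theorem B_pow_le_two_mul_sqrt {𝒩 : NeedletSystem} {N : ℕ} (hN : 2 ≤ N) {j : ℕ}
    (hj : 𝒩.B ^ (2 * j) ≤ N / Real.log N) : 𝒩.B ^ j ≤ 2 * Real.sqrt N := by
  have hN' : (2 : ℝ) ≤ N := by exact_mod_cast hN
  have hlog : 1 / 2 ≤ Real.log N := by
    have := Real.log_le_log two_pos hN'
    linarith [Real.log_two_gt_d9]
  have h1 : (𝒩.B ^ j) ^ 2 ≤ (2 * Real.sqrt N) ^ 2 := by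
    rw [← pow_mul, mul_comm j 2, mul_pow, Real.sq_sqrt (by linarith)]
    refine hj.trans ((div_le_iff₀ (by linarith)).2 ?_)
    nlinarith
  exact le_of_sq_le_sq h1 (by positivity)

theorem mainTheorem4 :
    -- the constants of the needlet norm bounds exist
    (∀ 𝒩 : NeedletSystem, ∃ C₂ Cinf : ℝ, 𝒩.NormBounds C₂ Cinf) ∧
    -- deviation bound, with absolute constants `cS`, `cη`, `C`
    (∃ cS cη C : ℝ, 0 < cS ∧ 0 < cη ∧ 0 < C ∧
      ∀ (𝒩 : NeedletSystem) (C₂ Cinf : ℝ), 𝒩.NormBounds C₂ Cinf →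
      ∀ (G S : ℝ) (s K : ℝ≥0) (δ κ : ℝ), 0 < δ → kappaStar C₂ Cinf G S s K cS cη δ < κ →
      ∀ g σ : S2 → ℝ, IsBoundedPair g σ G S →
      ∀ (N : ℕ), 2 ≤ N → ∀ (Ω : Type*) [MeasurableSpace Ω] (P : Measure Ω)
        [IsProbabilityMeasure P] (X : Fin N → Ω → S2) (ε : Fin N → Ω → ℝ),
        IsDesign P X ε s K →
      ∀ j : ℕ, 𝒩.B ^ (2 * j) ≤ N / Real.log N → ∀ k : Fin (𝒩.K j),
        P.real {ω | κ * tauN N ≤ |hErr 𝒩 g σ X ε j k ω|} ≤ C * (N : ℝ) ^ (-δ)) ∧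
    -- moment bounds
    (∀ (𝒩 : NeedletSystem) (G S : ℝ) (s K : ℝ≥0) (r : ℝ), 0 < r →
      ∃ C : ℝ, 0 < C ∧
      ∀ g σ : S2 → ℝ, IsBoundedPair g σ G S →
      ∀ (N : ℕ), 2 ≤ N → ∀ (Ω : Type*) [MeasurableSpace Ω] (P : Measure Ω)
        [IsProbabilityMeasure P] (X : Fin N → Ω → S2) (ε : Fin N → Ω → ℝ),
        IsDesign P X ε s K →
      ∀ j : ℕ, 𝒩.B ^ (2 * j) ≤ N / Real.log N →
        (∀ k : Fin (𝒩.K j),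
          Integrable (fun ω => |hErr 𝒩 g σ X ε j k ω| ^ r) P ∧
          ∫ ω, |hErr 𝒩 g σ X ε j k ω| ^ r ∂P ≤ C * (N : ℝ) ^ (-r / 2)) ∧
        Integrable (fun ω => ⨆ k : Fin (𝒩.K j), |hErr 𝒩 g σ X ε j k ω| ^ r) P ∧
        ∫ ω, (⨆ k : Fin (𝒩.K j), |hErr 𝒩 g σ X ε j k ω| ^ r) ∂P ≤
          C * ((j : ℝ) + 1) ^ r * (N : ℝ) ^ (-r / 2)) := by
  refine ⟨fun 𝒩 => ⟨1, 2 * 𝒩.B, 𝒩.normBounds⟩, ⟨1 / 1536, 1 / 512, 6, by norm_num, by norm_num,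
    by norm_num, ?_⟩, ?_⟩
  · intro 𝒩 C₂ Cinf hb G S s K δ κ hδ hκ g σ hgs N hN Ω _ P _ X ε h j hj k
    exact measureReal_hErr_le h hN hb hgs hj k hδ hκ
  · intro 𝒩 G S s K r hr
    obtain ⟨Cr, hCr, hrC⟩ := exists_rpow_le_rpow_add_exp hr
    obtain ⟨ℓ, hℓ, hcard⟩ := 𝒩.exists_card_le_exp
    have hB := 𝒩.B_pos
    set D : ℝ := G ^ 2 + 2 * s * |G * S| + 4 * (K : ℝ) ^ 2 * S ^ 2 with hD
    have hD0 : 0 ≤ D := by positivity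
    -- `3 c` must satisfy the smallness condition of the exponential moments, with `Cinf = 2 B`
    set c : ℝ := 1 / (12 * (D * (2 * 𝒩.B) + 1)) with hc
    have hc0 : 0 < c := by positivity
    have hcD : 3 * c * (D * (2 * 𝒩.B)) ≤ 1 / 4 := by
      have e1 : 3 * c * (D * (2 * 𝒩.B)) =
          1 / 4 * (D * (2 * 𝒩.B) / (D * (2 * 𝒩.B) + 1)) := by
        rw [hc]; field_simp; ring
      have e2 : D * (2 * 𝒩.B) / (D * (2 * 𝒩.B) + 1) ≤ 1 :=
        (div_le_one (by positivity)).2 (by linarith)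
      rw [e1]
      linarith
    set A : ℝ := 6 * Real.exp (32 * (3 * c) ^ 2 * (D ^ 2 * 1 ^ 2)) with hA
    have hA0 : 0 < A := by positivity
    have hcr : 0 < c ^ (-r) := Real.rpow_pos_of_pos hc0 _
    refine ⟨c ^ (-r) * (2 ^ r * ℓ ^ r + Cr * A), by positivity, ?_⟩
    intro g σ hgs N hN Ω _ P _ X ε h j hj
    have hN' : (0 : ℝ) < N := by
      have : (2 : ℝ) ≤ N := by exact_mod_cast hN
      linarith
    have hsq : 0 < Real.sqrt N := Real.sqrt_pos.2 hN'
    have hE : ∀ k : Fin (𝒩.K j),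
        Integrable (fun ω => Real.exp (c * Real.sqrt N * |hErr 𝒩 g σ X ε j k ω|)) P ∧
        ∫ ω, Real.exp (c * Real.sqrt N * |hErr 𝒩 g σ X ε j k ω|) ∂P ≤ A := by
      have q1 : 0 ≤ G ^ 2 := sq_nonneg G
      have q2 : 0 ≤ 2 * (s : ℝ) * |G * S| := by positivity
      have q3 : 0 ≤ 4 * (K : ℝ) ^ 2 * S ^ 2 := by positivity
      have q4 : 2 * (s : ℝ) * G * S ≤ 2 * (s : ℝ) * |G * S| := by
        rw [mul_assoc]
        exact mul_le_mul_of_nonneg_left (le_abs_self _) (by positivity)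
      exact fun k => integral_exp_abs_hErr_le h (by omega) 𝒩.normBounds hgs (D := D)
        (by linarith) (by linarith) (by linarith) k hc0.le (B_pow_le_two_mul_sqrt hN hj) hcD
    have hscale : (c * Real.sqrt N) ^ (-r) = c ^ (-r) * (N : ℝ) ^ (-r / 2) := by
      rw [Real.mul_rpow hc0.le hsq.le, Real.sqrt_eq_rpow, ← Real.rpow_mul hN'.le]
      congr 2
      ring
    have hNr : 0 < (N : ℝ) ^ (-r / 2) := Real.rpow_pos_of_pos hN' _
    refine ⟨fun k => ?_, ?_⟩
    · -- a single coefficient is a family with one member, for which `L = 0`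
      have h1 := integral_iSup_rpow_le hCr hrC (n := 1) (Y := fun _ => hErr 𝒩 g σ X ε j k)
        (fun _ => measurable_hErr h hgs j k) (a := c * Real.sqrt N) (L := 0) (by positivity)
        le_rfl (by simp) (fun _ => hE k) hA0.le
      simp only [ciSup_const] at h1
      refine ⟨h1.1, h1.2.trans ?_⟩
      rw [hscale, Real.zero_rpow hr.ne', mul_zero, zero_add]
      have h2 : 0 ≤ (2 : ℝ) ^ r * ℓ ^ r := by positivity
      calc c ^ (-r) * (N : ℝ) ^ (-r / 2) * (Cr * A)
          = c ^ (-r) * (Cr * A) * (N : ℝ) ^ (-r / 2) := by ring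
        _ ≤ _ := by gcongr; linarith
    · have h1 := integral_iSup_rpow_le hCr hrC (Y := fun k => hErr 𝒩 g σ X ε j k)
        (fun k => measurable_hErr h hgs j k) (a := c * Real.sqrt N) (L := ℓ * ((j : ℝ) + 1))
        (by positivity) (by positivity) (hcard j) hE hA0.le
      refine ⟨h1.1, h1.2.trans ?_⟩
      rw [hscale, Real.mul_rpow hℓ.le (by positivity)]
      have h2 : 1 ≤ ((j : ℝ) + 1) ^ r :=
        Real.one_le_rpow (by linarith [Nat.cast_nonneg (α := ℝ) j]) hr.le
      have h3 : Cr * A ≤ Cr * A * ((j : ℝ) + 1) ^ r := le_mul_of_one_le_right (by positivity) h2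
      calc c ^ (-r) * (N : ℝ) ^ (-r / 2) * (2 ^ r * (ℓ ^ r * ((j : ℝ) + 1) ^ r) + Cr * A)
          ≤ c ^ (-r) * (N : ℝ) ^ (-r / 2) *
            (2 ^ r * (ℓ ^ r * ((j : ℝ) + 1) ^ r) + Cr * A * ((j : ℝ) + 1) ^ r) := by gcongr
        _ = _ := by ring
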